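/- Let $d\ge 1$, $\pi_1\in(0,1)$, let $f$ be a probability density on $\mathbb R^d$ (with respect to Lebesgue measure) of a distribution $F$, and let $K:\mathbb R^d\to\mathbb R$ be a kernel, i.e. an integrable function with $\int K=1$. For a sample $X_1,\dots,X_n$ let $\mathcal U_n^1$ be the set of those values $X_i$ that appear exactly once among $X_1,\dots,X_n$, and for a bandwidth $h=h_n>0$ put $$\hat f_{\mathcal U_n^1}(x)=\frac{1}{(|\mathcal U_n^1|\vee 1)\,h^d}\sum_{i\in[n]:\,X_i\in\mathcal U_n^1}K\Big(\frac{x-X_i}{h}\Big),\qquad x\in\mathbb R^d .$$ (1) Let $H_1$ be a fixed discrete distribution on $\mathbb R^d$ with countable support, and for each $n$ let $X_1,\dots,X_n$ be i.i.d. from $(1-\pi_1)F+\pi_1H_1$. If $h\to0$ and $nh^d\to\infty$ as $n\to\infty$, then $$\mathbb E\int_{\mathbb R^d}|\hat f_{\mathcal U_n^1}(x)-f(x)|\,dx\longrightarrow 0 .$$ (2) Let $s,L,c,\alpha>0$. For each $n$ let $H_{1,n}$ be a discrete distribution with finite support $\mathcal S_n$ (which may grow with $n$) and probability mass function $(p^{(n)}_a)_{a\in\mathcal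 S_n}$, and let the sample $X_1,\dots,X_n$ of size $n$ be i.i.d. from $(1-\pi_1)F+\pi_1H_{1,n}$. Assume that for all large $n$ $$\min_{a\in\mathcal S_n}p^{(n)}_a\ \ge\ \frac1{\pi_1}\Big(1-\big(c\,n^{-\frac{2s}{2s+d}}\big)^{\frac1{n-1}}\Big).$$ Assume that $K$ is of order $\lfloor s\rfloor$, i.e. for every multi-index $r$ with $1\le|r|\le\lfloor s\rfloor$ the function $u^rK(u)$ is integrable with $\int u^rK(u)\,du=0$, that $\int K^2<\infty$ and that $\int\|u\|^s|K(u)|\,du<\infty$. Assume that $f\in\Sigma(s,L)$ for some compact set $\mathcal X\subset\mathbb R^d$, i.e. $f\in L^2$ vanishes outside $\mathcal X$, is of class $C^{\lfloor s\rfloor}$ on $\mathbb R^d$, and $|D^rf(x)-D^rf(y)|\le L\|x-y\|^{s-\lfloor s\rfloor}$ for all multi-indices $r$ with $|r|=\lfloor s\rfloor$ and all $x,y\in\mathcal X$. If $h=\alpha n^{-1/(2s+d)}$, then, as $n\to\infty$, $$\mathbb E\int_{\mathbb R^d}|\hat f_{\mathcal U_n^1}(x)-f(x)|\,dx=\mathcal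 O\big(n^{-\frac{s}{2s+d}}\big).$$ -/

import Mathlib

open MeasureTheory ProbabilityTheory Filter Topology
open scoped ENNReal

noncomputable section

namespace AtomKDE

/-- `f` is a probability density on `ℝ^d` with respect to Lebesgue measure. -/
def IsDensity {d : ℕ} (f : EuclideanSpace ℝ (Fin d) → ℝ) : Prop :=
  (∀ x, 0 ≤ f x) ∧ Integrable f ∧ ∫ x, f x = 1

/-- The mixture `(1 - π₁) F + π₁ H`, where `F` has Lebesgue density `f` and `H` is a discrete
distribution. A `PMF` always has countable support; `H.support` is its set of atoms and `H a` is
the mass of the atom `a`. -/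
def mixture {d : ℕ} (π₁ : ℝ) (f : EuclideanSpace ℝ (Fin d) → ℝ)
    (H : PMF (EuclideanSpace ℝ (Fin d))) : Measure (EuclideanSpace ℝ (Fin d)) :=
  ENNReal.ofReal (1 - π₁) • volume.withDensity (fun x => ENNReal.ofReal (f x)) +
    ENNReal.ofReal π₁ • H.toMeasure

/-- Under `P`, the random vectors `X 0, …, X (n - 1)` are independent with common law `μ`. -/
def IsIIDSample {d n : ℕ} {Ω : Type*} [MeasurableSpace Ω]
    (X : Fin n → Ω → EuclideanSpace ℝ (Fin d)) (μ : Measure (EuclideanSpace ℝ (Fin d)))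
    (P : Measure Ω) : Prop :=
  (∀ i, HasLaw (X i) μ P) ∧ iIndepFun X P

open Classical in
/-- The indices of the observations whose value appears exactly once among `x 0, …, x (n - 1)`.
Distinct such indices carry distinct values, so the cardinality of this set is also the number
of values that appear exactly once. -/
def uniqueIndices {d n : ℕ} (x : Fin n → EuclideanSpace ℝ (Fin d)) : Finset (Fin n) :=
  Finset.univ.filter fun i => ∀ j, x j = x i → j = i

/-- The kernel density estimator on `ℝ^d` with kernel `K` and bandwidth `h`, computed from the
observations that appear exactly once, and evaluated at `t`. -/
def uniqueKDE {d n : ℕ} (K : EuclideanSpace ℝ (Fin d) → ℝ) (h : ℝ)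
    (x : Fin n → EuclideanSpace ℝ (Fin d)) (t : EuclideanSpace ℝ (Fin d)) : ℝ :=
  1 / ((max (uniqueIndices x).card 1 : ℕ) * h ^ d) *
    ∑ i ∈ uniqueIndices x, K (h⁻¹ • (t - x i))

/-- The mean integrated absolute error `𝔼 ∫ |f̂(t) - f(t)| dt` over all of `ℝ^d`, as a value in
`[0, ∞]`. -/
def MIAE {d n : ℕ} {Ω : Type*} [MeasurableSpace Ω] (P : Measure Ω)
    (X : Fin n → Ω → EuclideanSpace ℝ (Fin d)) (K : EuclideanSpace ℝ (Fin d) → ℝ) (h : ℝ)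
    (f : EuclideanSpace ℝ (Fin d) → ℝ) : ℝ≥0∞ :=
  ∫⁻ ω, (∫⁻ t, ENNReal.ofReal |uniqueKDE K h (fun i => X i ω) t - f t|) ∂P

/-- A kernel: an integrable real function of integral one (not necessarily nonnegative). -/
def IsKernel {d : ℕ} (K : EuclideanSpace ℝ (Fin d) → ℝ) : Prop :=
  Integrable K ∧ ∫ u, K u = 1

/-- A kernel of order `m`: all monomial moments of degree `1, …, m` exist and vanish. -/
def IsKernelOfOrder {d : ℕ} (m : ℕ) (K : EuclideanSpace ℝ (Fin d) → ℝ) : Prop :=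
  IsKernel K ∧ ∀ r : Fin d → ℕ, 1 ≤ ∑ i, r i → ∑ i, r i ≤ m →
    Integrable (fun u => (∏ i, u i ^ r i) * K u) ∧ ∫ u, (∏ i, u i ^ r i) * K u = 0

/-- The Hölder class `Σ(s, L)` over the compact set `𝒳`, for functions extended by zero to
`ℝ^d`: square-integrable functions vanishing off `𝒳`, of class `C^⌊s⌋` on `ℝ^d`, all of whose
partial derivatives of order `⌊s⌋` are Hölder on `𝒳` with exponent `s - ⌊s⌋` and constant `L`.
A list of indices `i : Fin ⌊s⌋ → Fin d` names the partial derivative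
`∂^⌊s⌋ f / ∂x_{i 0} ⋯ ∂x_{i (⌊s⌋ - 1)}`. -/
def HolderClass {d : ℕ} (𝒳 : Set (EuclideanSpace ℝ (Fin d))) (s L : ℝ) :
    Set (EuclideanSpace ℝ (Fin d) → ℝ) :=
  {f | Function.support f ⊆ 𝒳 ∧ MemLp f 2 ∧ ContDiff ℝ (⌊s⌋₊ : ℕ) f ∧
    ∀ i : Fin ⌊s⌋₊ → Fin d, ∀ x ∈ 𝒳, ∀ y ∈ 𝒳,
      |iteratedFDeriv ℝ ⌊s⌋₊ f x (fun j => EuclideanSpace.single (i j) (1 : ℝ)) -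
        iteratedFDeriv ℝ ⌊s⌋₊ f y (fun j => EuclideanSpace.single (i j) (1 : ℝ))| ≤
      L * ‖x - y‖ ^ (s - (⌊s⌋₊ : ℝ))}

end AtomKDE

end

/-!
Let `A` be the set of atoms of the discrete component and `p = 1 - π₁`. Almost surely an observation
outside `A` is never repeated, so the unrepeated observations are exactly the `M` observations
outside `A` together with `D` "strays", the atoms that happen to be seen only once. Instead of
conditioning on the random set of clean observations, the proof works with the i.i.d. sum
`S t = ∑ i, 1_{Aᶜ} (X i) * K ((t - X i) / h)`, with mean `n * p * h ^ d * (K_h * f) t`. Up to the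
random normalisation, the estimator is `S` plus the contribution of the strays, so its `L¹` error is
bounded by the sum of

* the smoothing bias `‖K_h * f - f‖₁`;
* the fluctuation of `S`, estimated by Cauchy-Schwarz and the variance on a ball, and by first
  moments off that ball, where little mass is left;
* the number of strays, whose expectation is at most `n * ∑ a, μ {a} * (1 - μ {a}) ^ (n - 1)`;
* the binomial fluctuation of `M` around `n * p`, which also pays for the event that fewer than
  `n * p / 2` values are unrepeated, where the error is at most `‖K‖₁ + 1`.

This is `HasContinuousPart.MIAE_le`, which rests on the deterministic bound `lintegral_error_le` and
on the fluctuation bound `HasContinuousPart.lintegral_offSum_sub_le`.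

For consistency (`tendsto_MIAE`) the bias tends to `0` by continuity of translations in `L¹`, the
kernel is replaced in the variance term by a continuous compactly supported approximation, and the
proportion of strays tends to `0` by dominated convergence.

For the rate (`exists_MIAE_le_rate`) the Hölder condition, which is assumed on `𝒳` only, extends to
the whole space because the derivatives vanish off `𝒳`. Taylor's formula and the vanishing moments
of the kernel then give a bias of order `h ^ s` (`exists_lintegral_bias_le`). The moment
`∫ ‖u‖ ^ s * |K u|` makes the first-moment bound off a ball of order `h ^ s` too, so no decay of
`K ^ 2` is needed. The lower bound on the atom masses bounds the proportion of strays by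
`c * n ^ (-2 s / (2 s + d))`.
-/

namespace AtomKDE

variable {d : ℕ}

/-! ### Smoothing in `L¹` -/

lemma lintegral_comp_inv_smul (g : EuclideanSpace ℝ (Fin d) → ℝ≥0∞) {h : ℝ} (hh : 0 < h) :
    ∫⁻ t, g (h⁻¹ • t) = ENNReal.ofReal (h ^ d) * ∫⁻ u, g u := by
  have hne : h⁻¹ ≠ 0 := (inv_pos.2 hh).ne'
  have h1 := (Homeomorph.smulOfNeZero (α := EuclideanSpace ℝ (Fin d)) h⁻¹
    hne).measurableEmbedding.lintegral_map (μ := volume) g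
  have h2 := Measure.map_addHaar_smul (volume : Measure (EuclideanSpace ℝ (Fin d))) hne
  simp only [Homeomorph.smulOfNeZero_apply] at h1
  rw [← h1]
  rw [h2, lintegral_smul_measure, smul_eq_mul, finrank_euclideanSpace_fin, inv_pow, inv_inv,
    abs_of_pos (pow_pos hh d)]

lemma lintegral_comp_inv_smul_sub (g : EuclideanSpace ℝ (Fin d) → ℝ≥0∞) {h : ℝ} (hh : 0 < h)
    (x : EuclideanSpace ℝ (Fin d)) :
    ∫⁻ t, g (h⁻¹ • (t - x)) = ENNReal.ofReal (h ^ d) * ∫⁻ u, g u := by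
  rw [lintegral_sub_right_eq_self (fun t => g (h⁻¹ • t)) x, lintegral_comp_inv_smul g hh]

/-- The convolution of `f` with the dilated kernel `K (· / h)`, without the factor `h ^ d`. -/
noncomputable def smooth (K f : EuclideanSpace ℝ (Fin d) → ℝ) (h : ℝ)
    (t : EuclideanSpace ℝ (Fin d)) : ℝ :=
  ∫ x, K (h⁻¹ • (t - x)) * f x

lemma smooth_eq (K f : EuclideanSpace ℝ (Fin d) → ℝ) {h : ℝ} (hh : 0 < h)
    (t : EuclideanSpace ℝ (Fin d)) :
    smooth K f h t = h ^ d * ∫ u, K u * f (t - h • u) := by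
  have h1 : smooth K f h t = ∫ x, (fun y => K (h⁻¹ • y) * f (t - h • (h⁻¹ • y))) (t - x) := by
    simp only [smooth, smul_inv_smul₀ hh.ne', sub_sub_cancel]
  rw [h1, integral_sub_left_eq_self (fun y => K (h⁻¹ • y) * f (t - h • (h⁻¹ • y))) volume t,
    Measure.integral_comp_smul_of_nonneg volume (fun u => K u * f (t - h • u)) h⁻¹
      (hR := (inv_pos.2 hh).le), finrank_euclideanSpace_fin, inv_pow, inv_inv, smul_eq_mul]

lemma lintegral_lintegral_kernel_mul {K f : EuclideanSpace ℝ (Fin d) → ℝ} (hK : Measurable K)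
    (hf : Measurable f) {h : ℝ} (hh : 0 < h) :
    ∫⁻ t, ∫⁻ x, ‖K (h⁻¹ • (t - x))‖ₑ * ‖f x‖ₑ =
      ENNReal.ofReal (h ^ d) * ((∫⁻ u, ‖K u‖ₑ) * ∫⁻ x, ‖f x‖ₑ) := by
  rw [lintegral_lintegral_swap (by fun_prop)]
  have h1 : ∀ x, ∫⁻ t, ‖K (h⁻¹ • (t - x))‖ₑ * ‖f x‖ₑ =
      (ENNReal.ofReal (h ^ d) * ∫⁻ u, ‖K u‖ₑ) * ‖f x‖ₑ := by
    intro x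
    rw [lintegral_mul_const _ (by fun_prop),
      lintegral_comp_inv_smul_sub (fun u => ‖K u‖ₑ) hh]
  simp_rw [h1]
  rw [lintegral_const_mul _ (by fun_prop), mul_assoc]

lemma ae_integrable_kernel_mul {K f : EuclideanSpace ℝ (Fin d) → ℝ} (hK : Measurable K)
    (hf : Measurable f) (hKi : Integrable K) (hfi : Integrable f) {h : ℝ} (hh : 0 < h) :
    ∀ᵐ t, Integrable (fun x => K (h⁻¹ • (t - x)) * f x) := by
  have h1 : ∫⁻ t, ∫⁻ x, ‖K (h⁻¹ • (t - x))‖ₑ * ‖f x‖ₑ ≠ ∞ := by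
    rw [lintegral_lintegral_kernel_mul hK hf hh]
    exact ENNReal.mul_ne_top ENNReal.ofReal_ne_top
      (ENNReal.mul_ne_top hKi.hasFiniteIntegral.ne hfi.hasFiniteIntegral.ne)
  have h2 := ae_lt_top' (Measurable.lintegral_prod_right' (ν := volume)
    (f := fun q : EuclideanSpace ℝ (Fin d) × EuclideanSpace ℝ (Fin d) =>
      ‖K (h⁻¹ • (q.1 - q.2))‖ₑ * ‖f q.2‖ₑ) (by fun_prop)).aemeasurable h1
  filter_upwards [h2] with t ht
  refine ⟨(by fun_prop : Measurable _).aestronglyMeasurable, ?_⟩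
  simpa [HasFiniteIntegral, enorm_mul] using ht

/-- The mass that smoothing carries outside a ball of radius `R + ρ` comes either from kernel
arguments of norm at least `ρ / h` or from the part of `f` outside the ball of radius `R`. -/
lemma lintegral_tail_le {K f : EuclideanSpace ℝ (Fin d) → ℝ} (hK : Measurable K)
    (hf : Measurable f) {h : ℝ} (hh : 0 < h) (R ρ : ℝ) :
    ∫⁻ t in (Metric.closedBall 0 (R + ρ))ᶜ, ∫⁻ x, ‖K (h⁻¹ • (t - x))‖ₑ * ‖f x‖ₑ ≤
      ENNReal.ofReal (h ^ d) * ((∫⁻ u in {u | ρ / h ≤ ‖u‖}, ‖K u‖ₑ) * (∫⁻ x, ‖f x‖ₑ) +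
        (∫⁻ u, ‖K u‖ₑ) * ∫⁻ x in {x | R < ‖x‖}, ‖f x‖ₑ) := by
  have hS : MeasurableSet {u : EuclideanSpace ℝ (Fin d) | ρ / h ≤ ‖u‖} :=
    measurableSet_le measurable_const measurable_norm
  have hT : MeasurableSet {x : EuclideanSpace ℝ (Fin d) | R < ‖x‖} :=
    measurableSet_lt measurable_const measurable_norm
  have hB : MeasurableSet ((Metric.closedBall (0 : EuclideanSpace ℝ (Fin d)) (R + ρ))ᶜ) :=
    Metric.isClosed_closedBall.measurableSet.compl
  set K₁ : EuclideanSpace ℝ (Fin d) → ℝ := {u | ρ / h ≤ ‖u‖}.indicator K with hK₁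
  set f₁ : EuclideanSpace ℝ (Fin d) → ℝ := {x | R < ‖x‖}.indicator f with hf₁
  have mK₁ : Measurable K₁ := hK.indicator hS
  have mf₁ : Measurable f₁ := hf.indicator hT
  have e1 : ∫⁻ u in {u | ρ / h ≤ ‖u‖}, ‖K u‖ₑ = ∫⁻ u, ‖K₁ u‖ₑ := by
    rw [← lintegral_indicator hS]; simp [hK₁, enorm_indicator_eq_indicator_enorm]
  have e2 : ∫⁻ x in {x | R < ‖x‖}, ‖f x‖ₑ = ∫⁻ u, ‖f₁ u‖ₑ := by
    rw [← lintegral_indicator hT]; simp [hf₁, enorm_indicator_eq_indicator_enorm]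
  rw [e1, e2, mul_add, ← lintegral_lintegral_kernel_mul mK₁ hf hh,
    ← lintegral_lintegral_kernel_mul hK mf₁ hh, ← lintegral_add_left (by
      exact Measurable.lintegral_prod_right' (ν := volume)
        (f := fun q : EuclideanSpace ℝ (Fin d) × EuclideanSpace ℝ (Fin d) =>
        ‖K₁ (h⁻¹ • (q.1 - q.2))‖ₑ * ‖f q.2‖ₑ) (by fun_prop)), ← lintegral_indicator hB]
  refine lintegral_mono fun t => ?_
  by_cases ht : t ∈ (Metric.closedBall (0 : EuclideanSpace ℝ (Fin d)) (R + ρ))ᶜ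
  swap
  · simp [Set.indicator_of_notMem ht]
  rw [Set.indicator_of_mem ht, ← lintegral_add_left (by fun_prop)]
  refine lintegral_mono fun x => ?_
  simp only [Set.mem_compl_iff, mem_closedBall_zero_iff, not_le] at ht
  by_cases hx : R < ‖x‖
  · have : f₁ x = f x := Set.indicator_of_mem (by exact hx) f
    simp only [this]
    exact le_add_self
  · have hmem : ρ / h ≤ ‖h⁻¹ • (t - x)‖ := by
      rw [norm_smul, norm_inv, Real.norm_of_nonneg hh.le, div_eq_inv_mul]
      have := norm_sub_norm_le t x
      gcongr
      linarith
    have : K₁ (h⁻¹ • (t - x)) = K (h⁻¹ • (t - x)) := Set.indicator_of_mem (by exact hmem) K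
    simp only [this]
    exact le_self_add

lemma tendsto_lintegral_tail {K : EuclideanSpace ℝ (Fin d) → ℝ} (hKi : Integrable K) :
    Tendsto (fun r : ℝ => ∫⁻ u in {u | r ≤ ‖u‖}, ‖K u‖ₑ) atTop (𝓝 0) := by
  have hS : ∀ r : ℝ, MeasurableSet {u : EuclideanSpace ℝ (Fin d) | r ≤ ‖u‖} := fun r =>
    measurableSet_le measurable_const measurable_norm
  simp_rw [← fun r => lintegral_indicator (μ := volume) (hS r) (fun u => ‖K u‖ₑ)]
  have h0 : (0 : ℝ≥0∞) = ∫⁻ _ : EuclideanSpace ℝ (Fin d), 0 := by simp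
  rw [h0]
  refine tendsto_lintegral_filter_of_dominated_convergence' (fun u => ‖K u‖ₑ) ?_ ?_
    hKi.hasFiniteIntegral.ne ?_
  · exact Eventually.of_forall fun r => hKi.aestronglyMeasurable.enorm.indicator (hS r)
  · exact Eventually.of_forall fun r => ae_of_all _ fun u => Set.indicator_le_self _ _ u
  · refine ae_of_all _ fun u => ?_
    refine tendsto_const_nhds.congr' ?_
    filter_upwards [eventually_gt_atTop ‖u‖] with r hr
    rw [Set.indicator_of_notMem (by simpa using hr)]

/-- Translation is continuous in `L¹`. -/
lemma tendsto_lintegral_translate_sub {f : EuclideanSpace ℝ (Fin d) → ℝ} (hf : Measurable f)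
    (hfi : Integrable f) :
    Tendsto (fun y => ∫⁻ t, ‖f (t - y) - f t‖ₑ) (𝓝 0) (𝓝 0) := by
  rw [ENNReal.tendsto_nhds_zero]
  intro ε hε
  have hε3 : ε / 3 ≠ 0 := by simp [hε.ne']
  obtain ⟨g, hgc, hfg, hg, hgi⟩ := hfi.exists_hasCompactSupport_lintegral_sub_le hε3
  have hgt : Tendsto (fun y => ∫⁻ t, ‖g (t - y) - g t‖ₑ) (𝓝 0) (𝓝 0) := by
    obtain ⟨R, hR⟩ := hgc.isCompact.isBounded.subset_closedBall 0
    obtain ⟨C, hC⟩ := hg.bounded_above_of_compact_support hgc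
    have h0 : (0 : ℝ≥0∞) = ∫⁻ _ : EuclideanSpace ℝ (Fin d), 0 := by simp
    rw [h0]
    refine tendsto_lintegral_filter_of_dominated_convergence
      ((Metric.closedBall 0 (R + 1)).indicator fun _ => ENNReal.ofReal (2 * C)) ?_ ?_ ?_ ?_
    · exact Eventually.of_forall fun y => by fun_prop
    · filter_upwards [Metric.closedBall_mem_nhds (0 : EuclideanSpace ℝ (Fin d)) one_pos] with y hy
      refine ae_of_all _ fun t => ?_
      by_cases ht : t ∈ Metric.closedBall (0 : EuclideanSpace ℝ (Fin d)) (R + 1)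
      · rw [Set.indicator_of_mem ht, ← ofReal_norm]
        refine ENNReal.ofReal_le_ofReal ((norm_sub_le _ _).trans ?_)
        linarith [hC (t - y), hC t]
      · have h1 : g t = 0 := by
          by_contra hne
          have := hR (subset_tsupport g hne)
          simp only [mem_closedBall_zero_iff] at this ht
          linarith
        have h2 : g (t - y) = 0 := by
          by_contra hne
          have := hR (subset_tsupport g hne)
          simp only [mem_closedBall_zero_iff] at this ht hy
          linarith [norm_sub_norm_le t y]
        simp [h1, h2]
    · rw [lintegral_indicator Metric.isClosed_closedBall.measurableSet, setLIntegral_const]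
      exact ENNReal.mul_ne_top ENNReal.ofReal_ne_top (measure_closedBall_lt_top).ne
    · refine ae_of_all _ fun t => ?_
      have : Continuous fun y => ‖g (t - y) - g t‖ₑ := by fun_prop
      simpa using this.tendsto 0
  filter_upwards [(ENNReal.tendsto_nhds_zero.1 hgt) (ε / 3) (pos_iff_ne_zero.2 hε3)] with y hy
  have mg : Measurable g := hg.measurable
  calc ∫⁻ t, ‖f (t - y) - f t‖ₑ
      ≤ ∫⁻ t, (‖f (t - y) - g (t - y)‖ₑ + (‖g (t - y) - g t‖ₑ + ‖f t - g t‖ₑ)) := by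
        refine lintegral_mono fun t => ?_
        have : f (t - y) - f t =
          (f (t - y) - g (t - y)) + ((g (t - y) - g t) - (f t - g t)) := by ring
        rw [this]
        exact (enorm_add_le _ _).trans (add_le_add_right (enorm_sub_le) _)
    _ = (∫⁻ t, ‖f t - g t‖ₑ) + ((∫⁻ t, ‖g (t - y) - g t‖ₑ) + ∫⁻ t, ‖f t - g t‖ₑ) := by
        rw [lintegral_add_left (by fun_prop), lintegral_add_left (by fun_prop),
          lintegral_sub_right_eq_self (fun t => ‖f t - g t‖ₑ) y]
    _ ≤ ε / 3 + (ε / 3 + ε / 3) := by gcongr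
    _ = ε := by rw [← add_assoc, ENNReal.add_thirds]

/-- The integrated bias of smoothing is controlled by the `L¹` modulus of continuity of `f`. -/
lemma lintegral_bias_le {K f : EuclideanSpace ℝ (Fin d) → ℝ} (hK : Measurable K)
    (hf : Measurable f) (hKi : IsKernel K) (hfi : Integrable f) {h : ℝ} (hh : 0 < h) :
    ∫⁻ t, ‖(h ^ d)⁻¹ * smooth K f h t - f t‖ₑ ≤
      ∫⁻ u, ‖K u‖ₑ * ∫⁻ t, ‖f (t - h • u) - f t‖ₑ := by
  have key : ∀ᵐ t, ‖(h ^ d)⁻¹ * smooth K f h t - f t‖ₑ ≤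
      ∫⁻ u, ‖K u‖ₑ * ‖f (t - h • u) - f t‖ₑ := by
    filter_upwards [ae_integrable_kernel_mul hK hf hKi.1 hfi hh] with t ht
    have hi : Integrable fun u => K u * f (t - h • u) := by
      have h1 := ((integrable_comp_smul_iff volume (fun y => K (h⁻¹ • y) * f (t - y)) hh.ne').2
        (by simpa using ht.comp_sub_left t))
      simpa [inv_smul_smul₀ hh.ne'] using h1
    rw [smooth_eq K f hh, inv_mul_cancel_left₀ (pow_pos hh d).ne']
    have : (∫ u, K u * f (t - h • u)) - f t = ∫ u, K u * (f (t - h • u) - f t) := by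
      simp_rw [mul_sub]
      rw [integral_sub hi (hKi.1.mul_const _), integral_mul_const, hKi.2, one_mul]
    rw [this]
    refine (enorm_integral_le_lintegral_enorm _).trans_eq ?_
    simp [enorm_mul]
  refine (lintegral_mono_ae key).trans_eq ?_
  rw [lintegral_lintegral_swap (by fun_prop)]
  refine lintegral_congr fun u => ?_
  rw [lintegral_const_mul _ (by fun_prop)]

lemma tendsto_lintegral_bias {K f : EuclideanSpace ℝ (Fin d) → ℝ} (hK : Measurable K)
    (hf : Measurable f) (hKi : IsKernel K) (hfi : Integrable f) :
    Tendsto (fun h : ℝ => ∫⁻ t, ‖(h ^ d)⁻¹ * smooth K f h t - f t‖ₑ) (𝓝[>] 0) (𝓝 0) := by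
  have h0 : (0 : ℝ≥0∞) = ∫⁻ _ : EuclideanSpace ℝ (Fin d), 0 := by simp
  have main : Tendsto (fun h : ℝ => ∫⁻ u, ‖K u‖ₑ * ∫⁻ t, ‖f (t - h • u) - f t‖ₑ)
      (𝓝[>] (0 : ℝ)) (𝓝 0) := by
    rw [h0]
    refine tendsto_lintegral_filter_of_dominated_convergence
      (fun u => ‖K u‖ₑ * (2 * ∫⁻ t, ‖f t‖ₑ)) ?_ ?_ ?_ ?_
    · refine Eventually.of_forall fun h => Measurable.mul (by fun_prop) ?_
      exact Measurable.lintegral_prod_right' (ν := volume)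
        (f := fun q : EuclideanSpace ℝ (Fin d) × EuclideanSpace ℝ (Fin d) =>
        ‖f (q.2 - h • q.1) - f q.2‖ₑ) (by fun_prop)
    · refine Eventually.of_forall fun h => ae_of_all _ fun u => ?_
      gcongr
      calc ∫⁻ t, ‖f (t - h • u) - f t‖ₑ ≤ ∫⁻ t, (‖f (t - h • u)‖ₑ + ‖f t‖ₑ) :=
            lintegral_mono fun t => enorm_sub_le
        _ = 2 * ∫⁻ t, ‖f t‖ₑ := by
            rw [lintegral_add_left (by fun_prop),
              lintegral_sub_right_eq_self (fun t => ‖f t‖ₑ) (h • u), two_mul]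
    · rw [lintegral_mul_const _ (by fun_prop)]
      exact ENNReal.mul_ne_top hKi.1.hasFiniteIntegral.ne
        (ENNReal.mul_ne_top (by simp) hfi.hasFiniteIntegral.ne)
    · refine ae_of_all _ fun u => ?_
      have h1 : Tendsto (fun h : ℝ => h • u) (𝓝[>] 0) (𝓝 0) := by
        have : Continuous fun h : ℝ => h • u := by fun_prop
        simpa using (this.tendsto 0).mono_left nhdsWithin_le_nhds
      have h2 := (tendsto_lintegral_translate_sub hf hfi).comp h1
      have h3 := ENNReal.Tendsto.const_mul (a := ‖K u‖ₑ) h2 (Or.inr enorm_ne_top)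
      simpa using h3
  refine tendsto_of_tendsto_of_tendsto_of_le_of_le' tendsto_const_nhds main
    (Eventually.of_forall fun _ => zero_le) ?_
  filter_upwards [self_mem_nhdsWithin] with h hh
  exact lintegral_bias_le hK hf hKi hfi hh

/-! ### Mean deviation of i.i.d. sums and unrepeated atoms -/

section Deviation

variable {Ω S : Type*} [MeasurableSpace Ω] [MeasurableSpace S] {P : Measure Ω}
  [IsProbabilityMeasure P] {μ : Measure S} {n : ℕ} {X : Fin n → Ω → S}

lemma lintegral_sum_sub_sq_le (hX : ∀ i, Measurable (X i)) (hlaw : ∀ i, P.map (X i) = μ)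
    (hind : iIndepFun X P) {φ : S → ℝ} (hφ : Measurable φ) (hφ2 : MemLp φ 2 μ) :
    ∫⁻ ω, ‖(∑ i, φ (X i ω)) - n * ∫ x, φ x ∂μ‖ₑ ^ 2 ∂P ≤ n * ∫⁻ x, ‖φ x‖ₑ ^ 2 ∂μ := by
  have hm : ∀ i, MemLp (fun ω => φ (X i ω)) 2 P := fun i => by
    have h := hφ2
    rw [← hlaw i] at h
    exact h.comp_of_map (hX i).aemeasurable
  have hE : ∀ i, ∫ ω, φ (X i ω) ∂P = ∫ x, φ x ∂μ := fun i => by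
    rw [← hlaw i, integral_map (hX i).aemeasurable hφ.aestronglyMeasurable]
  have hsum : ∫ ω, (∑ i, fun ω => φ (X i ω)) ω ∂P = n * ∫ x, φ x ∂μ := by
    simp only [Finset.sum_apply]
    rw [integral_finsetSum _ fun i _ => (hm i).integrable (by norm_num)]
    simp [hE]
  have hmem : MemLp (∑ i, fun ω => φ (X i ω)) 2 P := memLp_finsetSum' _ fun i _ => hm i
  have hvar := IndepFun.variance_sum (s := Finset.univ) (X := fun i ω => φ (X i ω)) (μ := P)
    (fun i _ => hm i) fun i _ j _ hij => (hind.indepFun hij).comp hφ hφ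
  have h1 : ENNReal.ofReal (variance (∑ i, fun ω => φ (X i ω)) P) =
      ∫⁻ ω, ‖(∑ i, φ (X i ω)) - n * ∫ x, φ x ∂μ‖ₑ ^ 2 ∂P := by
    rw [hmem.ofReal_variance_eq, evariance, hsum]
    simp
  rw [← h1, hvar, ENNReal.ofReal_sum_of_nonneg fun i _ => variance_nonneg _ _]
  have h2 : ∀ i, ENNReal.ofReal (variance (fun ω => φ (X i ω)) P) ≤ ∫⁻ x, ‖φ x‖ₑ ^ 2 ∂μ := by
    intro i
    refine (ENNReal.ofReal_le_ofReal
      (variance_le_expectation_sq (hm i).aestronglyMeasurable)).trans ?_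
    rw [← hlaw i, lintegral_map (by fun_prop) (hX i)]
    simp only [Pi.pow_apply]
    rw [ofReal_integral_eq_lintegral_ofReal (hm i).integrable_sq (ae_of_all _ fun _ => sq_nonneg _)]
    refine (lintegral_congr fun ω => ?_).le
    rw [← ofReal_norm, ← ENNReal.ofReal_pow (norm_nonneg _)]
    simp
  refine (Finset.sum_le_sum fun i _ => h2 i).trans_eq ?_
  simp

lemma lintegral_le_sqrt_measure_mul_lintegral_sq {α : Type*} [MeasurableSpace α] {ν : Measure α}
    {g : α → ℝ≥0∞} (hg : AEMeasurable g ν) :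
    ∫⁻ a, g a ∂ν ≤ (ν Set.univ * ∫⁻ a, g a ^ 2 ∂ν) ^ (1 / 2 : ℝ) := by
  have h := ENNReal.lintegral_mul_le_Lp_mul_Lq ν (p := 2) (q := 2)
    (by constructor <;> norm_num) (f := fun _ => 1) (g := g) aemeasurable_const hg
  rw [ENNReal.mul_rpow_of_nonneg _ _ (by norm_num)]
  simpa using h

lemma lintegral_sum_sub_le_sqrt (hX : ∀ i, Measurable (X i)) (hlaw : ∀ i, P.map (X i) = μ)
    (hind : iIndepFun X P) {φ : S → ℝ} (hφ : Measurable φ) :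
    ∫⁻ ω, ‖(∑ i, φ (X i ω)) - n * ∫ x, φ x ∂μ‖ₑ ∂P ≤
      (n * ∫⁻ x, ‖φ x‖ₑ ^ 2 ∂μ) ^ (1 / 2 : ℝ) := by
  rcases Nat.eq_zero_or_pos n with rfl | hn
  · simp
  by_cases h2 : ∫⁻ x, ‖φ x‖ₑ ^ 2 ∂μ = ∞
  · rw [h2, ENNReal.mul_top (by exact_mod_cast hn.ne')]
    simp
  have hmem : MemLp φ 2 μ := by
    refine ⟨hφ.aestronglyMeasurable, ?_⟩
    rw [eLpNorm_lt_top_iff_lintegral_rpow_enorm_lt_top (by norm_num) (by norm_num)]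
    simpa using lt_top_iff_ne_top.2 h2
  refine (lintegral_le_sqrt_measure_mul_lintegral_sq (by fun_prop)).trans ?_
  simp only [measure_univ, one_mul]
  gcongr
  exact lintegral_sum_sub_sq_le hX hlaw hind hφ hmem

lemma lintegral_sum_sub_le_two_mul (hX : ∀ i, Measurable (X i)) (hlaw : ∀ i, P.map (X i) = μ)
    {φ : S → ℝ} (hφ : Measurable φ) :
    ∫⁻ ω, ‖(∑ i, φ (X i ω)) - n * ∫ x, φ x ∂μ‖ₑ ∂P ≤ 2 * n * ∫⁻ x, ‖φ x‖ₑ ∂μ := by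
  calc ∫⁻ ω, ‖(∑ i, φ (X i ω)) - n * ∫ x, φ x ∂μ‖ₑ ∂P
      ≤ ∫⁻ ω, ((∑ i, ‖φ (X i ω)‖ₑ) + n * ∫⁻ x, ‖φ x‖ₑ ∂μ) ∂P := by
        refine lintegral_mono fun ω => enorm_sub_le.trans ?_
        gcongr
        · exact enorm_sum_le _ _
        · rw [enorm_mul]
          gcongr
          · simp
          · exact enorm_integral_le_lintegral_enorm _
    _ = 2 * n * ∫⁻ x, ‖φ x‖ₑ ∂μ := by
        rw [lintegral_add_left (by fun_prop), lintegral_finsetSum _ (by fun_prop)]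
        have : ∀ i, ∫⁻ ω, ‖φ (X i ω)‖ₑ ∂P = ∫⁻ x, ‖φ x‖ₑ ∂μ := fun i => by
          rw [← hlaw i, lintegral_map (by fun_prop) (hX i)]
        simp [this]
        ring

/-- Mean absolute deviation of an i.i.d. sum whose summand splits into a part estimated by its
second moment and a part estimated by its first moment. -/
lemma lintegral_sum_sub_le (hX : ∀ i, Measurable (X i)) (hlaw : ∀ i, P.map (X i) = μ)
    (hind : iIndepFun X P) {φ₁ φ₂ : S → ℝ} (h1 : Measurable φ₁) (h2 : Measurable φ₂)
    (hi1 : Integrable φ₁ μ) (hi2 : Integrable φ₂ μ) :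
    ∫⁻ ω, ‖(∑ i, (φ₁ (X i ω) + φ₂ (X i ω))) - n * ∫ x, (φ₁ x + φ₂ x) ∂μ‖ₑ ∂P ≤
      (n * ∫⁻ x, ‖φ₁ x‖ₑ ^ 2 ∂μ) ^ (1 / 2 : ℝ) + 2 * n * ∫⁻ x, ‖φ₂ x‖ₑ ∂μ := by
  refine le_trans ?_ (add_le_add (lintegral_sum_sub_le_sqrt hX hlaw hind h1)
    (lintegral_sum_sub_le_two_mul hX hlaw h2))
  rw [← lintegral_add_left (by fun_prop)]
  refine lintegral_mono fun ω => ?_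
  rw [integral_add hi1 hi2, Finset.sum_add_distrib, mul_add, add_sub_add_comm]
  exact enorm_add_le _ _

end Deviation

/-- The probability that the `i`-th observation lies in the countable set `A` and is not
repeated. -/
lemma measure_unique_mem_le {Ω S : Type*} [MeasurableSpace Ω] [MeasurableSpace S]
    [MeasurableSingletonClass S] {P : Measure Ω} {μ : Measure S} [IsProbabilityMeasure μ]
    {n : ℕ} {X : Fin n → Ω → S} (hlaw : ∀ i, HasLaw (X i) μ P)
    (hind : iIndepFun X P) {A : Set S} (hA : A.Countable) (i : Fin n) :
    P {ω | X i ω ∈ A ∧ ∀ j, X j ω = X i ω → j = i} ≤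
      ∑' a : A, μ {(a : S)} * (1 - μ {(a : S)}) ^ (n - 1) := by
  classical
  have : Countable A := hA
  calc P {ω | X i ω ∈ A ∧ ∀ j, X j ω = X i ω → j = i}
      ≤ P (⋃ a : A, ⋂ j ∈ (Finset.univ : Finset (Fin n)),
          X j ⁻¹' (if j = i then {(a : S)} else {(a : S)}ᶜ)) := by
        refine measure_mono fun ω hω => ?_
        simp only [Set.mem_iUnion, Set.mem_iInter]
        refine ⟨⟨X i ω, hω.1⟩, fun j _ => ?_⟩
        split_ifs with hj
        · simp [hj]
        · exact fun h => hj (hω.2 j h)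
    _ ≤ ∑' a : A, P (⋂ j ∈ (Finset.univ : Finset (Fin n)),
          X j ⁻¹' (if j = i then {(a : S)} else {(a : S)}ᶜ)) := measure_iUnion_le _
    _ = ∑' a : A, μ {(a : S)} * (1 - μ {(a : S)}) ^ (n - 1) := by
        refine tsum_congr fun a => ?_
        have hms : ∀ j, MeasurableSet (if j = i then {(a : S)} else {(a : S)}ᶜ) := fun j => by
          split_ifs <;> simp
        rw [hind.measure_inter_preimage_eq_mul Finset.univ fun j _ => hms j]
        have hP : ∀ j, P (X j ⁻¹' (if j = i then {(a : S)} else {(a : S)}ᶜ)) =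
            if j = i then μ {(a : S)} else 1 - μ {(a : S)} := fun j => by
          rw [← Measure.map_apply_of_aemeasurable (hlaw j).aemeasurable (hms j), (hlaw j).map_eq]
          split_ifs
          · rfl
          · exact prob_compl_eq_one_sub (measurableSet_singleton _)
        simp_rw [hP]
        rw [← Finset.mul_prod_erase Finset.univ _ (Finset.mem_univ i), if_pos rfl]
        congr 1
        rw [Finset.prod_congr rfl fun j hj => if_neg (Finset.ne_of_mem_erase hj)]
        simp

/-! ### Deterministic bound for the `L¹` error -/

/-- The kernel sum over all observations outside the set `A`, without the factor `h ^ d` and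
without normalisation by the number of observations. -/
noncomputable def offSum {n : ℕ} (A : Set (EuclideanSpace ℝ (Fin d)))
    (K : EuclideanSpace ℝ (Fin d) → ℝ) (h : ℝ)
    (x : Fin n → EuclideanSpace ℝ (Fin d)) (t : EuclideanSpace ℝ (Fin d)) : ℝ :=
  ∑ i, Aᶜ.indicator (fun y => K (h⁻¹ • (t - y))) (x i)

/-- The number of observations outside the set `A`, as a real-valued sum of indicators. -/
noncomputable def offCount {n : ℕ} (A : Set (EuclideanSpace ℝ (Fin d)))
    (x : Fin n → EuclideanSpace ℝ (Fin d)) : ℝ :=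
  ∑ i, Aᶜ.indicator (fun _ => (1 : ℝ)) (x i)

open Classical in
/-- The number of unrepeated observations in the set `A`. -/
noncomputable def strayCount {n : ℕ} (A : Set (EuclideanSpace ℝ (Fin d)))
    (x : Fin n → EuclideanSpace ℝ (Fin d)) : ℕ :=
  ((uniqueIndices x).filter fun i => x i ∈ A).card

open Classical in
lemma sum_uniqueIndices {n : ℕ} {A : Set (EuclideanSpace ℝ (Fin d))}
    {x : Fin n → EuclideanSpace ℝ (Fin d)}
    (hx : ∀ i, x i ∉ A → ∀ j, x j = x i → j = i) (g : EuclideanSpace ℝ (Fin d) → ℝ) :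
    ∑ i ∈ uniqueIndices x, g (x i) =
      (∑ i, Aᶜ.indicator g (x i)) + ∑ i ∈ (uniqueIndices x).filter fun i => x i ∈ A, g (x i) := by
  rw [← Finset.sum_filter_not_add_sum_filter (uniqueIndices x) (fun i => x i ∈ A)]
  congr 1
  have h1 : (uniqueIndices x).filter (fun i => x i ∉ A) =
      Finset.univ.filter fun i => x i ∉ A := by
    ext i
    simp only [uniqueIndices, Finset.mem_filter, Finset.mem_univ, true_and]
    exact ⟨fun h => h.2, fun h => ⟨hx i h, h⟩⟩
  rw [h1, Finset.sum_filter]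
  refine Finset.sum_congr rfl fun i _ => ?_
  simp [Set.indicator_apply]

lemma card_uniqueIndices {n : ℕ} {A : Set (EuclideanSpace ℝ (Fin d))}
    {x : Fin n → EuclideanSpace ℝ (Fin d)}
    (hx : ∀ i, x i ∉ A → ∀ j, x j = x i → j = i) :
    ((uniqueIndices x).card : ℝ) = offCount A x + strayCount A x := by
  have := sum_uniqueIndices hx fun _ => (1 : ℝ)
  simpa [offCount, strayCount] using this

lemma lintegral_finset_kernel_le {ι : Type*} (s : Finset ι) {K : EuclideanSpace ℝ (Fin d) → ℝ}
    (hK : Measurable K) {h : ℝ} (hh : 0 < h) (x : ι → EuclideanSpace ℝ (Fin d)) :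
    ∫⁻ t, ‖∑ i ∈ s, K (h⁻¹ • (t - x i))‖ₑ ≤
      ENNReal.ofReal (h ^ d) * (s.card * ∫⁻ u, ‖K u‖ₑ) := by
  calc ∫⁻ t, ‖∑ i ∈ s, K (h⁻¹ • (t - x i))‖ₑ ≤ ∫⁻ t, ∑ i ∈ s, ‖K (h⁻¹ • (t - x i))‖ₑ :=
        lintegral_mono fun t => enorm_sum_le _ _
    _ = ENNReal.ofReal (h ^ d) * (s.card * ∫⁻ u, ‖K u‖ₑ) := by
        rw [lintegral_finsetSum _ (by fun_prop)]
        simp only [lintegral_comp_inv_smul_sub (fun u => ‖K u‖ₑ) hh, Finset.sum_const, nsmul_eq_mul]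
        ring

/-- The `L¹` error in terms of the sum over observations outside `A` centred at its mean `m`
times `f`, of the number of such observations, and of the number of strays. If the sample
contains fewer than `m / 2` unrepeated values, the error is at most `‖K‖₁ + 1`, and this is paid
for by the squared deviation of the count from `m`. -/
lemma lintegral_error_le {n : ℕ} {A : Set (EuclideanSpace ℝ (Fin d))}
    {x : Fin n → EuclideanSpace ℝ (Fin d)}
    (hx : ∀ i, x i ∉ A → ∀ j, x j = x i → j = i) {K f : EuclideanSpace ℝ (Fin d) → ℝ}
    (hK : Measurable K) (hf : Measurable f) (hf1 : ∫⁻ t, ‖f t‖ₑ = 1) {h : ℝ} (hh : 0 < h)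
    {m : ℝ} (hm : 0 < m) :
    ∫⁻ t, ‖uniqueKDE K h x t - f t‖ₑ ≤
      ENNReal.ofReal (2 / m) * (ENNReal.ofReal (h ^ d)⁻¹ *
          (∫⁻ t, ‖offSum A K h x t - m * h ^ d * f t‖ₑ) +
        ((∫⁻ u, ‖K u‖ₑ) + 1) * strayCount A x + ‖offCount A x - m‖ₑ + 1) +
      ((∫⁻ u, ‖K u‖ₑ) + 1) * (ENNReal.ofReal (4 / m ^ 2) * ‖offCount A x - m‖ₑ ^ 2) := by
  classical
  have hb : 0 < h ^ d := pow_pos hh d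
  set b := h ^ d with hbdef
  set k := ∫⁻ u, ‖K u‖ₑ with hk
  set κ : ℕ := max (uniqueIndices x).card 1 with hκ
  have hκ1 : (1 : ℝ) ≤ κ := by exact_mod_cast le_max_right _ _
  have hκ0 : (0 : ℝ) < κ := by linarith
  have hκN : ((uniqueIndices x).card : ℝ) ≤ κ := by exact_mod_cast le_max_left _ _
  have hκN' : (κ : ℝ) ≤ (uniqueIndices x).card + 1 := by
    have : κ ≤ (uniqueIndices x).card + 1 := by omega
    exact_mod_cast this
  have hN := card_uniqueIndices hx
  -- The normalisation `κ` is bounded below, or so few values are unrepeated that the count of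
  -- observations outside `A`, which is at most `κ`, lies at distance at least `m / 2` from `m`.
  by_cases hc : m / 2 ≤ κ
  · refine le_trans ?_ le_self_add
    have hdec : ∀ t, uniqueKDE K h x t - f t = (κ : ℝ)⁻¹ * (b⁻¹ *
        ((offSum A K h x t - m * b * f t) +
          ∑ i ∈ (uniqueIndices x).filter fun i => x i ∈ A, K (h⁻¹ • (t - x i))) +
        (m - κ) * f t) := by
      intro t
      rw [uniqueKDE, sum_uniqueIndices hx (fun y => K (h⁻¹ • (t - y))), ← hκ, ← hbdef, offSum]
      field_simp
      ring
    have mS : Measurable fun t => offSum A K h x t := by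
      refine Finset.measurable_sum _ fun i _ => ?_
      by_cases hi : x i ∈ Aᶜ
      · simp only [Set.indicator_of_mem hi]; fun_prop
      · simp only [Set.indicator_of_notMem hi]; fun_prop
    calc ∫⁻ t, ‖uniqueKDE K h x t - f t‖ₑ
        ≤ ∫⁻ t, ENNReal.ofReal (κ : ℝ)⁻¹ * (ENNReal.ofReal b⁻¹ *
          (‖offSum A K h x t - m * b * f t‖ₑ +
          ‖∑ i ∈ (uniqueIndices x).filter fun i => x i ∈ A, K (h⁻¹ • (t - x i))‖ₑ) +
          ‖m - κ‖ₑ * ‖f t‖ₑ) := by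
          refine lintegral_mono fun t => ?_
          rw [hdec t, enorm_mul, Real.enorm_of_nonneg (inv_nonneg.2 hκ0.le)]
          gcongr
          refine (enorm_add_le _ _).trans ?_
          rw [enorm_mul, enorm_mul, Real.enorm_of_nonneg (inv_nonneg.2 hb.le)]
          gcongr
          exact enorm_add_le _ _
      _ = ENNReal.ofReal (κ : ℝ)⁻¹ * (ENNReal.ofReal b⁻¹ *
          ((∫⁻ t, ‖offSum A K h x t - m * b * f t‖ₑ) +
          ∫⁻ t, ‖∑ i ∈ (uniqueIndices x).filter fun i => x i ∈ A, K (h⁻¹ • (t - x i))‖ₑ) +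
          ‖m - κ‖ₑ) := by
          rw [lintegral_const_mul _ (by fun_prop), lintegral_add_left (by fun_prop),
            lintegral_const_mul _ (by fun_prop), lintegral_add_left (by fun_prop),
            lintegral_const_mul _ (by fun_prop), hf1, mul_one]
      _ ≤ ENNReal.ofReal (2 / m) * (ENNReal.ofReal b⁻¹ *
          ((∫⁻ t, ‖offSum A K h x t - m * b * f t‖ₑ) +
            ENNReal.ofReal b * (strayCount A x * k)) +
          (‖offCount A x - m‖ₑ + strayCount A x + 1)) := by
          gcongr
          · rw [← inv_div]
            exact inv_anti₀ (by positivity) hc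
          · exact lintegral_finset_kernel_le _ hK hh x
          · have : ‖m - κ‖ₑ ≤ ENNReal.ofReal (|offCount A x - m| + strayCount A x + 1) := by
              rw [← ofReal_norm, Real.norm_eq_abs]
              refine ENNReal.ofReal_le_ofReal (abs_le.2 ⟨?_, ?_⟩)
              · linarith [le_abs_self (offCount A x - m)]
              · have : (0 : ℝ) ≤ strayCount A x := Nat.cast_nonneg _
                linarith [neg_abs_le (offCount A x - m)]
            refine this.trans_eq ?_
            rw [ENNReal.ofReal_add (by positivity) (by positivity),
              ENNReal.ofReal_add (by positivity) (by positivity), ← Real.norm_eq_abs,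
              ofReal_norm, ENNReal.ofReal_natCast, ENNReal.ofReal_one]
      _ = _ := by
          rw [mul_add (ENNReal.ofReal b⁻¹), ← mul_assoc (ENNReal.ofReal b⁻¹) (ENNReal.ofReal b),
            ← ENNReal.ofReal_mul (by positivity), inv_mul_cancel₀ hb.ne']
          simp only [ENNReal.ofReal_one]
          ring
  · refine le_trans ?_ le_add_self
    push Not at hc
    have h1 : (1 : ℝ≥0∞) ≤ ENNReal.ofReal (4 / m ^ 2) * ‖offCount A x - m‖ₑ ^ 2 := by
      rw [← ofReal_norm, ← ENNReal.ofReal_pow (norm_nonneg _),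
        ← ENNReal.ofReal_mul (by positivity), ENNReal.one_le_ofReal, Real.norm_eq_abs, sq_abs,
        div_mul_eq_mul_div, one_le_div (by positivity)]
      have : (0 : ℝ) ≤ strayCount A x := Nat.cast_nonneg _
      have h3 : m / 2 ≤ m - offCount A x := by linarith
      nlinarith [mul_self_le_mul_self (by positivity) h3]
    refine le_trans ?_ (mul_le_mul_right h1 _)
    rw [mul_one]
    calc ∫⁻ t, ‖uniqueKDE K h x t - f t‖ₑ
        ≤ ∫⁻ t, (ENNReal.ofReal (1 / (κ * b)) *
            ‖∑ i ∈ uniqueIndices x, K (h⁻¹ • (t - x i))‖ₑ + ‖f t‖ₑ) := by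
          refine lintegral_mono fun t => enorm_sub_le.trans ?_
          rw [uniqueKDE, enorm_mul, Real.enorm_of_nonneg (by positivity)]
      _ = ENNReal.ofReal (1 / (κ * b)) *
            (∫⁻ t, ‖∑ i ∈ uniqueIndices x, K (h⁻¹ • (t - x i))‖ₑ) + 1 := by
          rw [lintegral_add_left (by fun_prop), lintegral_const_mul _ (by fun_prop), hf1]
      _ ≤ ENNReal.ofReal (1 / (κ * b)) * (ENNReal.ofReal b *
            ((uniqueIndices x).card * k)) + 1 := by
          gcongr
          exact lintegral_finset_kernel_le _ hK hh x
      _ = ENNReal.ofReal (1 / (κ * b) * b * (uniqueIndices x).card) * k + 1 := by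
          rw [ENNReal.ofReal_mul (by positivity), ENNReal.ofReal_mul (by positivity),
            ENNReal.ofReal_natCast]
          ring
      _ ≤ 1 * k + 1 := by
          gcongr
          rw [ENNReal.ofReal_le_one]
          have : 1 / (κ * b) * b * ((uniqueIndices x).card : ℝ) = (uniqueIndices x).card / κ := by
            field_simp
          rw [this]
          exact div_le_one_of_le₀ hκN hκ0.le
      _ = k + 1 := by rw [one_mul]

/-! ### Laws with a density off a countable set -/

/-- `μ` is a probability measure that, off the countable set `A`, has density `p * f`, where `f` is
a measurable probability density and `0 < p ≤ 1`. Nothing is required of `μ` on `A`. -/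
structure HasContinuousPart (μ : Measure (EuclideanSpace ℝ (Fin d)))
    (A : Set (EuclideanSpace ℝ (Fin d))) (p : ℝ) (f : EuclideanSpace ℝ (Fin d) → ℝ) : Prop where
  prob : IsProbabilityMeasure μ
  countable : A.Countable
  pos : 0 < p
  le_one : p ≤ 1
  measurable : Measurable f
  nonneg : ∀ x, 0 ≤ f x
  lintegral_eq : ∫⁻ x, ‖f x‖ₑ = 1
  restrict_eq : μ.restrict Aᶜ =
    ENNReal.ofReal p • volume.withDensity fun x => ENNReal.ofReal (f x)

namespace HasContinuousPart

variable {μ : Measure (EuclideanSpace ℝ (Fin d))} {A : Set (EuclideanSpace ℝ (Fin d))} {p : ℝ}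
  {f : EuclideanSpace ℝ (Fin d) → ℝ}

lemma measurableSet_compl (hμ : HasContinuousPart μ A p f) : MeasurableSet Aᶜ :=
  hμ.countable.measurableSet.compl

lemma integrable (hμ : HasContinuousPart μ A p f) : Integrable f :=
  ⟨hμ.measurable.aestronglyMeasurable, by simp [HasFiniteIntegral, hμ.lintegral_eq]⟩

lemma integral_eq_one (hμ : HasContinuousPart μ A p f) : ∫ x, f x = 1 := by
  rw [integral_eq_lintegral_of_nonneg_ae (ae_of_all _ hμ.nonneg)
    hμ.measurable.aestronglyMeasurable]
  have := hμ.lintegral_eq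
  simp_rw [fun x => Real.enorm_of_nonneg (hμ.nonneg x)] at this
  simp [this]

lemma lintegral_indicator (hμ : HasContinuousPart μ A p f)
    {g : EuclideanSpace ℝ (Fin d) → ℝ≥0∞} (hg : Measurable g) :
    ∫⁻ x, Aᶜ.indicator g x ∂μ = ENNReal.ofReal p * ∫⁻ x, g x * ‖f x‖ₑ := by
  rw [MeasureTheory.lintegral_indicator hμ.measurableSet_compl, hμ.restrict_eq,
    lintegral_smul_measure, lintegral_withDensity_eq_lintegral_mul _
      (hμ.measurable.ennreal_ofReal) hg]
  simp only [Pi.mul_apply, smul_eq_mul]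
  simp_rw [fun x => Real.enorm_of_nonneg (hμ.nonneg x), mul_comm]

lemma lintegral_enorm_indicator (hμ : HasContinuousPart μ A p f)
    {g : EuclideanSpace ℝ (Fin d) → ℝ} (hg : Measurable g) :
    ∫⁻ x, ‖Aᶜ.indicator g x‖ₑ ∂μ = ENNReal.ofReal p * ∫⁻ x, ‖g x‖ₑ * ‖f x‖ₑ := by
  rw [← hμ.lintegral_indicator hg.enorm]
  simp [enorm_indicator_eq_indicator_enorm]

lemma lintegral_enorm_sq_indicator (hμ : HasContinuousPart μ A p f)
    {g : EuclideanSpace ℝ (Fin d) → ℝ} (hg : Measurable g) :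
    ∫⁻ x, ‖Aᶜ.indicator g x‖ₑ ^ 2 ∂μ = ENNReal.ofReal p * ∫⁻ x, ‖g x‖ₑ ^ 2 * ‖f x‖ₑ := by
  rw [← hμ.lintegral_indicator (g := fun x => ‖g x‖ₑ ^ 2) (by fun_prop)]
  refine lintegral_congr fun x => ?_
  by_cases hx : x ∈ Aᶜ
  · simp [Set.indicator_of_mem hx]
  · simp [Set.indicator_of_notMem hx]

lemma integrable_indicator (hμ : HasContinuousPart μ A p f)
    {g : EuclideanSpace ℝ (Fin d) → ℝ} (hg : Measurable g)
    (hgf : Integrable fun x => g x * f x) : Integrable (Aᶜ.indicator g) μ := by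
  refine ⟨(hg.indicator hμ.measurableSet_compl).aestronglyMeasurable, ?_⟩
  rw [HasFiniteIntegral, hμ.lintegral_enorm_indicator hg]
  refine ENNReal.mul_lt_top ENNReal.ofReal_lt_top ?_
  simpa [HasFiniteIntegral, enorm_mul] using hgf.2

lemma integral_indicator (hμ : HasContinuousPart μ A p f)
    (g : EuclideanSpace ℝ (Fin d) → ℝ) :
    ∫ x, Aᶜ.indicator g x ∂μ = p * ∫ x, g x * f x := by
  rw [MeasureTheory.integral_indicator hμ.measurableSet_compl, hμ.restrict_eq,
    integral_smul_measure, integral_withDensity_eq_integral_toReal_smul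
      hμ.measurable.ennreal_ofReal (ae_of_all _ fun _ => ENNReal.ofReal_lt_top),
    ENNReal.toReal_ofReal hμ.pos.le]
  simp only [smul_eq_mul]
  simp_rw [fun x => ENNReal.toReal_ofReal (hμ.nonneg x), mul_comm]

lemma measure_singleton (hμ : HasContinuousPart μ A p f) (hd : 0 < d)
    {x : EuclideanSpace ℝ (Fin d)} (hx : x ∉ A) : μ {x} = 0 := by
  have : Nonempty (Fin d) := ⟨⟨0, hd⟩⟩
  have h1 : μ {x} = μ.restrict Aᶜ {x} := by
    rw [Measure.restrict_apply (measurableSet_singleton x)]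
    congr 1
    ext y
    simp only [Set.mem_singleton_iff, Set.mem_inter_iff, Set.mem_compl_iff]
    exact ⟨fun h => ⟨h, h ▸ hx⟩, fun h => h.1⟩
  rw [h1, hμ.restrict_eq, Measure.smul_apply, withDensity_apply _ (measurableSet_singleton x)]
  simp

variable {Ω : Type*} [MeasurableSpace Ω] {P : Measure Ω} {n : ℕ}
  {X : Fin n → Ω → EuclideanSpace ℝ (Fin d)}

/-- Almost surely no observation outside `A` is repeated, since the law has no atom there. -/
lemma ae_unique (hμ : HasContinuousPart μ A p f) (hd : 0 < d) (hX : ∀ i, Measurable (X i))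
    (hs : IsIIDSample X μ P) :
    ∀ᵐ ω ∂P, ∀ i, X i ω ∉ A → ∀ j, X j ω = X i ω → j = i := by
  have := hμ.prob
  have := hs.2.isProbabilityMeasure
  rw [ae_all_iff]
  intro i
  have key : ∀ j, ∀ᵐ ω ∂P, X i ω ∉ A → X j ω = X i ω → j = i := by
    intro j
    by_cases hij : j = i
    · exact ae_of_all _ fun _ _ _ => hij
    have hmap := (indepFun_iff_map_prod_eq_prod_map_map (hX i).aemeasurable
      (hX j).aemeasurable).1 (hs.2.indepFun (Ne.symm hij))
    rw [(hs.1 i).map_eq, (hs.1 j).map_eq] at hmap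
    have hSm : MeasurableSet {q : EuclideanSpace ℝ (Fin d) × EuclideanSpace ℝ (Fin d) |
        q.1 ∈ Aᶜ ∧ q.2 = q.1} :=
      (measurable_fst hμ.measurableSet_compl).inter
        (measurableSet_eq_fun measurable_snd measurable_fst)
    have h0 : (μ.prod μ) {q : EuclideanSpace ℝ (Fin d) × EuclideanSpace ℝ (Fin d) |
        q.1 ∈ Aᶜ ∧ q.2 = q.1} = 0 := by
      rw [Measure.prod_apply hSm, lintegral_eq_zero_iff (measurable_measure_prodMk_left hSm)]
      refine ae_of_all _ fun x => ?_
      by_cases hx : x ∈ A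
      · simp [hx]
      · simpa [hx] using hμ.measure_singleton hd hx
    rw [← hmap, Measure.map_apply ((hX i).prodMk (hX j)) hSm] at h0
    rw [ae_iff]
    refine measure_mono_null (fun ω hω => ?_) h0
    simp only [Set.mem_ofPred_eq, Classical.not_imp] at hω
    exact ⟨hω.1, hω.2.1⟩
  filter_upwards [ae_all_iff.2 key] with ω hω hi j hj using hω j hi hj

lemma lintegral_strayCount_le (hμ : HasContinuousPart μ A p f) (hX : ∀ i, Measurable (X i))
    (hs : IsIIDSample X μ P) :
    ∫⁻ ω, (strayCount A (fun i => X i ω) : ℝ≥0∞) ∂P ≤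
      n * ∑' a : A, μ {(a : EuclideanSpace ℝ (Fin d))} *
        (1 - μ {(a : EuclideanSpace ℝ (Fin d))}) ^ (n - 1) := by
  classical
  have := hμ.prob
  have hm : ∀ i, MeasurableSet {ω | X i ω ∈ A ∧ ∀ j, X j ω = X i ω → j = i} := by
    intro i
    have hset : {ω | X i ω ∈ A ∧ ∀ j, X j ω = X i ω → j = i} =
        X i ⁻¹' A ∩ ⋂ j, {ω | X j ω = X i ω → j = i} := by
      ext ω
      simp
    rw [hset]
    refine (hX i hμ.countable.measurableSet).inter (MeasurableSet.iInter fun j => ?_)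
    by_cases hij : j = i
    · simp [hij]
    · have hne : {ω | X j ω = X i ω → j = i} = {ω | X j ω = X i ω}ᶜ := by
        ext ω
        simp [hij]
      rw [hne]
      exact (measurableSet_eq_fun (hX j) (hX i)).compl
  have h1 : ∀ ω, (strayCount A (fun i => X i ω) : ℝ≥0∞) =
      ∑ i, {ω | X i ω ∈ A ∧ ∀ j, X j ω = X i ω → j = i}.indicator 1 ω := by
    intro ω
    rw [strayCount, uniqueIndices, Finset.filter_filter, Finset.card_filter]
    push_cast
    refine Finset.sum_congr rfl fun i _ => ?_
    simp [Set.indicator_apply, and_comm]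
  simp_rw [h1]
  rw [lintegral_finsetSum _ fun i _ => measurable_one.indicator (hm i)]
  simp_rw [fun i => lintegral_indicator_one (μ := P) (hm i)]
  refine (Finset.sum_le_sum fun i _ =>
    measure_unique_mem_le hs.1 hs.2 hμ.countable i).trans_eq ?_
  simp

lemma lintegral_offCount_sq_le (hμ : HasContinuousPart μ A p f) (hX : ∀ i, Measurable (X i))
    (hs : IsIIDSample X μ P) :
    ∫⁻ ω, ‖offCount A (fun i => X i ω) - n * p‖ₑ ^ 2 ∂P ≤ n := by
  have := hμ.prob
  have := hs.2.isProbabilityMeasure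
  have hφ : Measurable (Aᶜ.indicator fun _ : EuclideanSpace ℝ (Fin d) => (1 : ℝ)) :=
    measurable_const.indicator hμ.measurableSet_compl
  have h1 := lintegral_sum_sub_sq_le hX (fun i => (hs.1 i).map_eq) hs.2 hφ
    ((memLp_const (1 : ℝ)).indicator hμ.measurableSet_compl)
  rw [hμ.integral_indicator, hμ.lintegral_enorm_sq_indicator measurable_const] at h1
  simp only [one_mul, hμ.integral_eq_one, mul_one, enorm_one, one_pow, hμ.lintegral_eq] at h1
  refine h1.trans ?_
  refine (mul_le_mul_right (ENNReal.ofReal_le_one.2 hμ.le_one) _).trans_eq (mul_one _)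

lemma measurable_offCount (hμ : HasContinuousPart μ A p f) (hX : ∀ i, Measurable (X i)) :
    Measurable fun ω => offCount A fun i => X i ω :=
  Finset.measurable_sum _ fun i _ =>
    (measurable_const.indicator hμ.measurableSet_compl).comp (hX i)

lemma lintegral_offCount_le (hμ : HasContinuousPart μ A p f) (hX : ∀ i, Measurable (X i))
    (hs : IsIIDSample X μ P) :
    ∫⁻ ω, ‖offCount A (fun i => X i ω) - n * p‖ₑ ∂P ≤ ENNReal.ofReal (√n) := by
  have := hs.2.isProbabilityMeasure
  have mo := hμ.measurable_offCount hX
  refine (lintegral_le_sqrt_measure_mul_lintegral_sq (mo.sub_const _).enorm.aemeasurable).trans ?_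
  simp only [measure_univ, one_mul]
  rw [Real.sqrt_eq_rpow, ← ENNReal.ofReal_rpow_of_nonneg (by positivity) (by positivity),
    ENNReal.ofReal_natCast]
  gcongr
  exact hμ.lintegral_offCount_sq_le hX hs

lemma integrable_kernel (hμ : HasContinuousPart μ A p f) {K : EuclideanSpace ℝ (Fin d) → ℝ}
    (hK : Measurable K) (hKi : Integrable K) {h : ℝ} (hh : 0 < h) :
    ∀ᵐ t, Integrable (Aᶜ.indicator fun y => K (h⁻¹ • (t - y))) μ := by
  filter_upwards [ae_integrable_kernel_mul hK hμ.measurable hKi hμ.integrable hh] with t ht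
  exact hμ.integrable_indicator (by fun_prop) ht

/-- The mean `L¹` distance between the kernel sum over the observations outside `A` and its
expectation. On the ball of radius `R + ρ` the part `K₁` of the kernel is handled through variances
and the rest through first moments; off the ball only first moments are used. -/
lemma lintegral_offSum_sub_le (hμ : HasContinuousPart μ A p f) (hX : ∀ i, Measurable (X i))
    (hs : IsIIDSample X μ P) {K K₁ : EuclideanSpace ℝ (Fin d) → ℝ}
    (hK : Measurable K) (hKi : Integrable K) (hK₁ : Measurable K₁) (hKi₁ : Integrable K₁)
    {h : ℝ} (hh : 0 < h) (R ρ : ℝ) :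
    ∫⁻ t, ∫⁻ ω, ‖offSum A K h (fun i => X i ω) t - n * (p * smooth K f h t)‖ₑ ∂P ≤
      (volume (Metric.closedBall (0 : EuclideanSpace ℝ (Fin d)) (R + ρ)) *
        (n * (ENNReal.ofReal (h ^ d) * ∫⁻ u, ‖K₁ u‖ₑ ^ 2))) ^ (1 / 2 : ℝ) +
      2 * n * ENNReal.ofReal p * (ENNReal.ofReal (h ^ d) *
        ((∫⁻ u, ‖K u - K₁ u‖ₑ) + ((∫⁻ u in {u | ρ / h ≤ ‖u‖}, ‖K u‖ₑ) +
        (∫⁻ u, ‖K u‖ₑ) * ∫⁻ x in {x | R < ‖x‖}, ‖f x‖ₑ))) := by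
  have := hμ.prob
  have := hs.2.isProbabilityMeasure
  have hmap := fun i => (hs.1 i).map_eq
  have mf := hμ.measurable
  set B := Metric.closedBall (0 : EuclideanSpace ℝ (Fin d)) (R + ρ) with hB
  have mB : MeasurableSet B := Metric.isClosed_closedBall.measurableSet
  have mK₂ : Measurable fun u => K u - K₁ u := hK.sub hK₁
  have hmean : ∀ t, p * smooth K f h t = ∫ x, Aᶜ.indicator (fun y => K (h⁻¹ • (t - y))) x ∂μ :=
    fun t => (hμ.integral_indicator _).symm
  rw [← lintegral_add_compl _ mB]
  have hin : ∫⁻ t in B, ∫⁻ ω, ‖offSum A K h (fun i => X i ω) t - n * (p * smooth K f h t)‖ₑ ∂P ≤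
      (volume B * (n * (ENNReal.ofReal (h ^ d) * ∫⁻ u, ‖K₁ u‖ₑ ^ 2))) ^ (1 / 2 : ℝ) +
      2 * n * ENNReal.ofReal p * (ENNReal.ofReal (h ^ d) * ∫⁻ u, ‖K u - K₁ u‖ₑ) := by
    have mV : Measurable fun t => n * ∫⁻ x, ‖K₁ (h⁻¹ • (t - x))‖ₑ ^ 2 * ‖f x‖ₑ :=
      (Measurable.lintegral_prod_right' (ν := volume)
        (f := fun q : EuclideanSpace ℝ (Fin d) × EuclideanSpace ℝ (Fin d) =>
        ‖K₁ (h⁻¹ • (q.1 - q.2))‖ₑ ^ 2 * ‖f q.2‖ₑ) (by fun_prop)).const_mul _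
    calc ∫⁻ t in B, ∫⁻ ω, ‖offSum A K h (fun i => X i ω) t - n * (p * smooth K f h t)‖ₑ ∂P
        ≤ ∫⁻ t in B, ((n * ∫⁻ x, ‖K₁ (h⁻¹ • (t - x))‖ₑ ^ 2 * ‖f x‖ₑ) ^ (1 / 2 : ℝ) +
          2 * n * (ENNReal.ofReal p *
            ∫⁻ x, ‖K (h⁻¹ • (t - x)) - K₁ (h⁻¹ • (t - x))‖ₑ * ‖f x‖ₑ)) := by
          refine lintegral_mono_ae (ae_restrict_of_ae ?_)
          filter_upwards [hμ.integrable_kernel hK₁ hKi₁ hh,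
            hμ.integrable_kernel mK₂ (hKi.sub hKi₁) hh] with t ht1 ht2
          have hdev := lintegral_sum_sub_le hX hmap hs.2
            ((by fun_prop : Measurable fun y => K₁ (h⁻¹ • (t - y))).indicator
              hμ.measurableSet_compl)
            ((by fun_prop : Measurable fun y => K (h⁻¹ • (t - y)) - K₁ (h⁻¹ • (t - y))).indicator
              hμ.measurableSet_compl) ht1 ht2
          have hsplit : ∀ x, Aᶜ.indicator (fun y => K₁ (h⁻¹ • (t - y))) x +
              Aᶜ.indicator (fun y => K (h⁻¹ • (t - y)) - K₁ (h⁻¹ • (t - y))) x =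
              Aᶜ.indicator (fun y => K (h⁻¹ • (t - y))) x := fun x => by
            by_cases hx : x ∈ Aᶜ
            · simp [Set.indicator_of_mem hx]
            · simp [Set.indicator_of_notMem hx]
          simp only [hsplit] at hdev
          rw [hmean]
          refine hdev.trans ?_
          rw [hμ.lintegral_enorm_sq_indicator (by fun_prop),
            hμ.lintegral_enorm_indicator (by fun_prop)]
          gcongr
          exact (mul_le_mul_left (ENNReal.ofReal_le_one.2 hμ.le_one) _).trans_eq (one_mul _)
      _ ≤ (∫⁻ t in B, (n * ∫⁻ x, ‖K₁ (h⁻¹ • (t - x))‖ₑ ^ 2 * ‖f x‖ₑ) ^ (1 / 2 : ℝ)) +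
          ∫⁻ t, 2 * n * (ENNReal.ofReal p *
            ∫⁻ x, ‖K (h⁻¹ • (t - x)) - K₁ (h⁻¹ • (t - x))‖ₑ * ‖f x‖ₑ) := by
          rw [lintegral_add_left (mV.pow_const _)]
          gcongr
          exact Measure.restrict_le_self
      _ ≤ _ := by
          gcongr
          · refine (lintegral_le_sqrt_measure_mul_lintegral_sq
              (mV.pow_const _).aemeasurable).trans ?_
            have hsq : ∀ a : ℝ≥0∞, (a ^ (1 / 2 : ℝ)) ^ 2 = a := fun a => by
              rw [← ENNReal.rpow_natCast, ← ENNReal.rpow_mul]; norm_num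
            simp only [hsq, Measure.restrict_apply_univ]
            gcongr
            refine (setLIntegral_le_lintegral _ _).trans ?_
            rw [lintegral_const_mul' _ _ (ENNReal.natCast_ne_top n)]
            gcongr
            have := lintegral_lintegral_kernel_mul (hK₁.pow_const 2) mf hh
            simp only [enorm_pow, hμ.lintegral_eq, mul_one] at this
            exact this.le
          · rw [lintegral_const_mul' _ _ (ENNReal.mul_ne_top (by simp) (by simp)),
              lintegral_const_mul' _ _ ENNReal.ofReal_ne_top,
              lintegral_lintegral_kernel_mul mK₂ mf hh, hμ.lintegral_eq, mul_one,
              mul_assoc (2 * (n : ℝ≥0∞))]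
  have hout : ∫⁻ t in Bᶜ, ∫⁻ ω, ‖offSum A K h (fun i => X i ω) t -
        n * (p * smooth K f h t)‖ₑ ∂P ≤
      2 * n * ENNReal.ofReal p * (ENNReal.ofReal (h ^ d) *
        ((∫⁻ u in {u | ρ / h ≤ ‖u‖}, ‖K u‖ₑ) +
        (∫⁻ u, ‖K u‖ₑ) * ∫⁻ x in {x | R < ‖x‖}, ‖f x‖ₑ)) := by
    calc ∫⁻ t in Bᶜ, ∫⁻ ω, ‖offSum A K h (fun i => X i ω) t - n * (p * smooth K f h t)‖ₑ ∂P
        ≤ ∫⁻ t in Bᶜ, 2 * n * (ENNReal.ofReal p * ∫⁻ x, ‖K (h⁻¹ • (t - x))‖ₑ * ‖f x‖ₑ) := by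
          refine lintegral_mono fun t => ?_
          rw [hmean, ← hμ.lintegral_enorm_indicator (by fun_prop)]
          exact lintegral_sum_sub_le_two_mul hX hmap
            ((by fun_prop : Measurable fun y => K (h⁻¹ • (t - y))).indicator
              hμ.measurableSet_compl)
      _ ≤ _ := by
          rw [lintegral_const_mul' _ _ (ENNReal.mul_ne_top (by simp) (by simp)),
            lintegral_const_mul' _ _ ENNReal.ofReal_ne_top, ← mul_assoc]
          gcongr
          have := lintegral_tail_le hK mf hh R ρ
          rwa [hμ.lintegral_eq, mul_one] at this
  refine (add_le_add hin hout).trans_eq ?_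
  ring

end HasContinuousPart

/-! ### The risk bound -/

namespace HasContinuousPart

variable {μ : Measure (EuclideanSpace ℝ (Fin d))} {A : Set (EuclideanSpace ℝ (Fin d))} {p : ℝ}
  {f : EuclideanSpace ℝ (Fin d) → ℝ} {Ω : Type*} [MeasurableSpace Ω] {P : Measure Ω} {n : ℕ}
  {X : Fin n → Ω → EuclideanSpace ℝ (Fin d)}

lemma measurable_offSum (hμ : HasContinuousPart μ A p f) (hX : ∀ i, Measurable (X i))
    {K : EuclideanSpace ℝ (Fin d) → ℝ} (hK : Measurable K) (h : ℝ) :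
    Measurable fun q : Ω × EuclideanSpace ℝ (Fin d) =>
      offSum A K h (fun i => X i q.1) q.2 := by
  refine Finset.measurable_sum _ fun i _ => ?_
  have h1 : Measurable fun q : Ω × EuclideanSpace ℝ (Fin d) => K (h⁻¹ • (q.2 - X i q.1)) := by
    have := hX i
    fun_prop
  have h2 : MeasurableSet {q : Ω × EuclideanSpace ℝ (Fin d) | X i q.1 ∈ Aᶜ} :=
    ((hX i).comp measurable_fst) hμ.measurableSet_compl
  exact h1.indicator h2

lemma lintegral_offSum_sub_density_le (hμ : HasContinuousPart μ A p f)
    (hX : ∀ i, Measurable (X i)) (hs : IsIIDSample X μ P) {K : EuclideanSpace ℝ (Fin d) → ℝ}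
    (hK : Measurable K) {h : ℝ} (hh : 0 < h) :
    ∫⁻ ω, (∫⁻ t, ‖offSum A K h (fun i => X i ω) t - n * p * h ^ d * f t‖ₑ) ∂P ≤
      (∫⁻ t, ∫⁻ ω, ‖offSum A K h (fun i => X i ω) t - n * (p * smooth K f h t)‖ₑ ∂P) +
      ENNReal.ofReal (n * p * h ^ d) * ∫⁻ t, ‖(h ^ d)⁻¹ * smooth K f h t - f t‖ₑ := by
  have := hs.2.isProbabilityMeasure
  have hb : 0 < h ^ d := pow_pos hh d
  have hp := hμ.pos
  have mf := hμ.measurable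
  have mS := hμ.measurable_offSum hX hK h
  have mG : Measurable (smooth K f h) := by
    refine (StronglyMeasurable.integral_prod_right' (ν := volume)
      (f := fun q : EuclideanSpace ℝ (Fin d) × EuclideanSpace ℝ (Fin d) =>
        K (h⁻¹ • (q.1 - q.2)) * f q.2) ?_).measurable
    exact (by fun_prop : Measurable _).stronglyMeasurable
  calc ∫⁻ ω, (∫⁻ t, ‖offSum A K h (fun i => X i ω) t - n * p * h ^ d * f t‖ₑ) ∂P
      ≤ ∫⁻ ω, (∫⁻ t, (‖offSum A K h (fun i => X i ω) t - n * (p * smooth K f h t)‖ₑ +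
          ENNReal.ofReal (n * p * h ^ d) * ‖(h ^ d)⁻¹ * smooth K f h t - f t‖ₑ)) ∂P := by
        refine lintegral_mono fun ω => lintegral_mono fun t => ?_
        have : offSum A K h (fun i => X i ω) t - n * p * h ^ d * f t =
            (offSum A K h (fun i => X i ω) t - n * (p * smooth K f h t)) +
            (n * p * h ^ d) * ((h ^ d)⁻¹ * smooth K f h t - f t) := by
          field_simp
          ring
        rw [this]
        refine (enorm_add_le _ _).trans_eq ?_
        rw [enorm_mul, Real.enorm_of_nonneg (by positivity : 0 ≤ n * p * h ^ d)]
    _ = (∫⁻ ω, (∫⁻ t, ‖offSum A K h (fun i => X i ω) t - n * (p * smooth K f h t)‖ₑ) ∂P) +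
          ENNReal.ofReal (n * p * h ^ d) * ∫⁻ t, ‖(h ^ d)⁻¹ * smooth K f h t - f t‖ₑ := by
        rw [← lintegral_const_mul _ (by fun_prop)]
        simp_rw [fun ω => lintegral_add_right (μ := volume)
          (fun t => ‖offSum A K h (fun i => X i ω) t - n * (p * smooth K f h t)‖ₑ)
          (g := fun t => ENNReal.ofReal (n * p * h ^ d) * ‖(h ^ d)⁻¹ * smooth K f h t - f t‖ₑ)
          (by fun_prop)]
        rw [lintegral_add_right _ measurable_const]
        simp
    _ = _ := by
        rw [lintegral_lintegral_swap]
        refine (Measurable.enorm ?_).aemeasurable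
        exact mS.sub (((mG.comp measurable_snd).const_mul p).const_mul (n : ℝ))

/-- The basic risk bound: smoothing bias, fluctuation on a ball, tails, strays, and the
fluctuation of the number of observations from the continuous component. -/
lemma MIAE_le (hμ : HasContinuousPart μ A p f) (hd : 0 < d) (hn : 0 < n)
    (hX : ∀ i, Measurable (X i)) (hs : IsIIDSample X μ P)
    {K K₁ : EuclideanSpace ℝ (Fin d) → ℝ} (hK : Measurable K) (hKi : Integrable K)
    (hK₁ : Measurable K₁) (hKi₁ : Integrable K₁) {h : ℝ} (hh : 0 < h) (R ρ : ℝ) :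
    MIAE P X K h f ≤
      2 * (∫⁻ t, ‖(h ^ d)⁻¹ * smooth K f h t - f t‖ₑ) +
      (volume (Metric.closedBall (0 : EuclideanSpace ℝ (Fin d)) (R + ρ)) *
        ∫⁻ u, ‖K₁ u‖ₑ ^ 2) ^ (1 / 2 : ℝ) * ENNReal.ofReal (2 / p * (√(n * h ^ d))⁻¹) +
      4 * ((∫⁻ u, ‖K u - K₁ u‖ₑ) + ((∫⁻ u in {u | ρ / h ≤ ‖u‖}, ‖K u‖ₑ) +
        (∫⁻ u, ‖K u‖ₑ) * ∫⁻ x in {x | R < ‖x‖}, ‖f x‖ₑ)) +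
      ((∫⁻ u, ‖K u‖ₑ) + 1) * ENNReal.ofReal (2 / p) *
        (∑' a : A, μ {(a : EuclideanSpace ℝ (Fin d))} *
          (1 - μ {(a : EuclideanSpace ℝ (Fin d))}) ^ (n - 1)) +
      ENNReal.ofReal (2 / p * ((√n)⁻¹ + (n : ℝ)⁻¹)) +
      ((∫⁻ u, ‖K u‖ₑ) + 1) * ENNReal.ofReal (4 / p ^ 2 * (n : ℝ)⁻¹) := by
  have := hs.2.isProbabilityMeasure
  have hb : 0 < h ^ d := pow_pos hh d
  have hp := hμ.pos
  have hn' : (0 : ℝ) < n := by exact_mod_cast hn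
  have hm : (0 : ℝ) < n * p := by positivity
  have mf := hμ.measurable
  have mS := hμ.measurable_offSum hX hK h
  have mo := hμ.measurable_offCount hX
  set k := ∫⁻ u, ‖K u‖ₑ with hk
  have hkt : k + 1 ≠ ∞ := by
    simpa using hKi.hasFiniteIntegral.ne
  have mI : Measurable fun ω => ∫⁻ t, ‖offSum A K h (fun i => X i ω) t - n * p * h ^ d * f t‖ₑ :=
    Measurable.lintegral_prod_right' (ν := volume)
      (f := fun q : Ω × EuclideanSpace ℝ (Fin d) =>
        ‖offSum A K h (fun i => X i q.1) q.2 - n * p * h ^ d * f q.2‖ₑ) (by fun_prop)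
  -- The stray count stands last in the sum, so that integrating term by term does not require its
  -- measurability.
  have h1 : MIAE P X K h f ≤
      ENNReal.ofReal (2 / (n * p)) * (ENNReal.ofReal (h ^ d)⁻¹ *
          (∫⁻ ω, (∫⁻ t, ‖offSum A K h (fun i => X i ω) t - n * p * h ^ d * f t‖ₑ) ∂P) +
        ((∫⁻ ω, ‖offCount A (fun i => X i ω) - n * p‖ₑ ∂P) +
        (1 + (k + 1) * ∫⁻ ω, (strayCount A (fun i => X i ω) : ℝ≥0∞) ∂P))) +
      (k + 1) * (ENNReal.ofReal (4 / (n * p) ^ 2) *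
        ∫⁻ ω, ‖offCount A (fun i => X i ω) - n * p‖ₑ ^ 2 ∂P) := by
    calc MIAE P X K h f
        ≤ ∫⁻ ω, (ENNReal.ofReal (2 / (n * p)) * (ENNReal.ofReal (h ^ d)⁻¹ *
          (∫⁻ t, ‖offSum A K h (fun i => X i ω) t - n * p * h ^ d * f t‖ₑ) +
        (‖offCount A (fun i => X i ω) - n * p‖ₑ +
        (1 + (k + 1) * strayCount A (fun i => X i ω)))) +
      (k + 1) * (ENNReal.ofReal (4 / (n * p) ^ 2) *
        ‖offCount A (fun i => X i ω) - n * p‖ₑ ^ 2)) ∂P := by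
          refine lintegral_mono_ae ?_
          filter_upwards [hμ.ae_unique hd hX hs] with ω hω
          simp_rw [← Real.enorm_eq_ofReal_abs]
          refine (lintegral_error_le hω hK mf hμ.lintegral_eq hh hm).trans_eq ?_
          rw [← hk]
          ring
      _ = _ := by
          rw [lintegral_add_right _ (by fun_prop), lintegral_const_mul' _ _ ENNReal.ofReal_ne_top,
            lintegral_add_left (by fun_prop), lintegral_add_left (by fun_prop),
            lintegral_add_left (by fun_prop), lintegral_const_mul' _ _ ENNReal.ofReal_ne_top,
            lintegral_const_mul' _ _ hkt, lintegral_const_mul' _ _ hkt,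
            lintegral_const_mul' _ _ ENNReal.ofReal_ne_top]
          simp
  have h2 := (hμ.lintegral_offSum_sub_density_le hX hs hK hh).trans
    (add_le_add_left (hμ.lintegral_offSum_sub_le hX hs hK hKi hK₁ hKi₁ hh R ρ) _)
  refine h1.trans ?_
  refine (add_le_add (mul_le_mul_right (add_le_add (mul_le_mul_right h2 _)
    (add_le_add (hμ.lintegral_offCount_le hX hs)
    (add_le_add_right (mul_le_mul_right (hμ.lintegral_strayCount_le hX hs) _) _))) _)
    (mul_le_mul_right (mul_le_mul_right (hμ.lintegral_offCount_sq_le hX hs) _) _)).trans_eq ?_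
  rw [← hk]
  generalize (∫⁻ t, ‖(h ^ d)⁻¹ * smooth K f h t - f t‖ₑ) = bias
  generalize volume (Metric.closedBall (0 : EuclideanSpace ℝ (Fin d)) (R + ρ)) = v
  generalize (∫⁻ u, ‖K₁ u‖ₑ ^ 2) = κ
  generalize ((∫⁻ u, ‖K u - K₁ u‖ₑ) + ((∫⁻ u in {u | ρ / h ≤ ‖u‖}, ‖K u‖ₑ) +
        k * ∫⁻ x in {x | R < ‖x‖}, ‖f x‖ₑ)) = tail
  generalize (∑' a : A, μ {(a : EuclideanSpace ℝ (Fin d))} *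
          (1 - μ {(a : EuclideanSpace ℝ (Fin d))}) ^ (n - 1)) = q
  generalize h ^ d = b at hb ⊢
  have e1 : ENNReal.ofReal (2 / (n * p)) * ENNReal.ofReal b⁻¹ * ENNReal.ofReal (n * p * b) = 2 := by
    rw [← ENNReal.ofReal_mul (by positivity), ← ENNReal.ofReal_mul (by positivity)]
    have : 2 / (n * p) * b⁻¹ * (n * p * b) = 2 := by field_simp
    rw [this]; simp
  have e2 : ENNReal.ofReal (2 / (n * p)) * ENNReal.ofReal b⁻¹ *
      (2 * n * ENNReal.ofReal p * ENNReal.ofReal b) = 4 := by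
    have : (2 * n * ENNReal.ofReal p * ENNReal.ofReal b) =
        2 * ENNReal.ofReal (n * p * b) := by
      rw [ENNReal.ofReal_mul (by positivity), ENNReal.ofReal_mul (by positivity),
        ENNReal.ofReal_natCast]
      ring
    rw [this, mul_left_comm, e1]
    norm_num
  have e3 : ENNReal.ofReal (2 / (n * p)) * ENNReal.ofReal b⁻¹ *
      (v * (n * (ENNReal.ofReal b * κ))) ^ (1 / 2 : ℝ) =
      (v * κ) ^ (1 / 2 : ℝ) * ENNReal.ofReal (2 / p * (√(n * b))⁻¹) := by
    have : v * (n * (ENNReal.ofReal b * κ)) = (v * κ) * ENNReal.ofReal (n * b) := by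
      rw [ENNReal.ofReal_mul (by positivity), ENNReal.ofReal_natCast]
      ring
    rw [this, ENNReal.mul_rpow_of_nonneg _ _ (by norm_num),
      ENNReal.ofReal_rpow_of_nonneg (by positivity) (by norm_num), ← Real.sqrt_eq_rpow,
      mul_left_comm, ← ENNReal.ofReal_mul (by positivity), ← ENNReal.ofReal_mul (by positivity)]
    congr 2
    have hs : √(n * b) ≠ 0 := by positivity
    have hsq : √(n * b) * √(n * b) = n * b := Real.mul_self_sqrt (by positivity)
    field_simp
    rw [sq, hsq]
  have e4 : ENNReal.ofReal (2 / (n * p)) * (ENNReal.ofReal (√n) + 1) =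
      ENNReal.ofReal (2 / p * ((√n)⁻¹ + (n : ℝ)⁻¹)) := by
    rw [← ENNReal.ofReal_one, ← ENNReal.ofReal_add (by positivity) (by positivity),
      ← ENNReal.ofReal_mul (by positivity)]
    congr 1
    have hs : √(n : ℝ) ≠ 0 := by positivity
    have hsq : √(n : ℝ) * √(n : ℝ) = n := Real.mul_self_sqrt (by positivity)
    field_simp
    rw [← sq] at hsq
    linear_combination hsq
  have e5 : ENNReal.ofReal (2 / (n * p)) * n = ENNReal.ofReal (2 / p) := by
    rw [← ENNReal.ofReal_natCast, ← ENNReal.ofReal_mul (by positivity)]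
    congr 1
    field_simp
  have e6 : ENNReal.ofReal (4 / (n * p) ^ 2) * n = ENNReal.ofReal (4 / p ^ 2 * (n : ℝ)⁻¹) := by
    rw [← ENNReal.ofReal_natCast, ← ENNReal.ofReal_mul (by positivity)]
    congr 1
    field_simp
  rw [← e6, ← e5, ← e4, ← e3]
  rw [← congrArg (· * bias) e1, ← congrArg (· * tail) e2]
  ring

end HasContinuousPart

/-! ### Taylor expansion in a Hölder class -/

/-- The partial derivatives of order `k` of `f` at `x`, indexed by lists of coordinates. -/
noncomputable def partialDeriv {k : ℕ} (f : EuclideanSpace ℝ (Fin d) → ℝ) (i : Fin k → Fin d)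
    (x : EuclideanSpace ℝ (Fin d)) : ℝ :=
  iteratedFDeriv ℝ k f x fun j => EuclideanSpace.single (i j) (1 : ℝ)

lemma iteratedFDeriv_apply_const_eq (f : EuclideanSpace ℝ (Fin d) → ℝ) (k : ℕ)
    (x y : EuclideanSpace ℝ (Fin d)) :
    iteratedFDeriv ℝ k f x (fun _ => y) =
      ∑ i : Fin k → Fin d, (∏ j, y (i j)) * partialDeriv f i x := by
  have hy : y = ∑ a, y a • EuclideanSpace.single a (1 : ℝ) := by
    simpa using ((EuclideanSpace.basisFun (Fin d) ℝ).sum_repr y).symm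
  conv_lhs => rw [hy]
  rw [ContinuousMultilinearMap.map_sum]
  refine Finset.sum_congr rfl fun i _ => ?_
  rw [ContinuousMultilinearMap.map_smul_univ, smul_eq_mul, partialDeriv]

lemma continuous_partialDeriv {k : ℕ} {f : EuclideanSpace ℝ (Fin d) → ℝ}
    (hf : ContDiff ℝ k f) (i : Fin k → Fin d) : Continuous (partialDeriv f i) :=
  (ContinuousMultilinearMap.apply ℝ (fun _ : Fin k => EuclideanSpace ℝ (Fin d)) ℝ _).continuous.comp
    (hf.continuous_iteratedFDeriv le_rfl)

lemma partialDeriv_eq_zero {k : ℕ} {f : EuclideanSpace ℝ (Fin d) → ℝ}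
    {𝒳 : Set (EuclideanSpace ℝ (Fin d))} (h𝒳 : IsClosed 𝒳) (hf : Function.support f ⊆ 𝒳)
    (i : Fin k → Fin d) {x : EuclideanSpace ℝ (Fin d)} (hx : x ∉ 𝒳) : partialDeriv f i x = 0 := by
  have h1 : x ∉ Function.support (iteratedFDeriv ℝ k f) := fun h =>
    hx (closure_minimal hf h𝒳 (support_iteratedFDeriv_subset k h))
  rw [partialDeriv, Function.notMem_support.1 h1]
  simp

/-- A Hölder condition on a closed set extends to the whole space for a continuous function that
vanishes off the set: a segment leaving the set crosses its boundary, where the function is `0`. -/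
lemma abs_sub_le_of_holderOn {E : Type*} [NormedAddCommGroup E] [NormedSpace ℝ E] {g : E → ℝ}
    (hg : Continuous g) {𝒳 : Set E} (h𝒳 : IsClosed 𝒳) (h0 : ∀ x ∉ 𝒳, g x = 0) {L β : ℝ}
    (hβ : 0 ≤ β) (hL : ∀ x ∈ 𝒳, ∀ y ∈ 𝒳, |g x - g y| ≤ L * ‖x - y‖ ^ β) (x y : E) :
    |g x - g y| ≤ |L| * ‖x - y‖ ^ β := by
  have key : ∀ x ∈ 𝒳, ∀ y ∉ 𝒳, |g x - g y| ≤ |L| * ‖x - y‖ ^ β := by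
    intro x hx y hy
    obtain ⟨z, hz, hzX, hz0⟩ : ∃ z ∈ segment ℝ x y, z ∈ 𝒳 ∧ g z = 0 := by
      have hT : IsCompact (Set.Icc (0 : ℝ) 1 ∩ (fun τ => x + τ • (y - x)) ⁻¹' 𝒳) :=
        isCompact_Icc.inter_right (h𝒳.preimage (by fun_prop))
      -- The last point of the segment that belongs to `𝒳`.
      obtain ⟨τ, hτ, hmax⟩ := hT.exists_isMaxOn ⟨0, by simpa using hx⟩
        (f := id) continuousOn_id
      refine ⟨x + τ • (y - x), ?_, hτ.2, ?_⟩
      · rw [segment_eq_image']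
        exact ⟨τ, hτ.1, rfl⟩
      · have hτ1 : τ < 1 := by
          refine lt_of_le_of_ne hτ.1.2 fun h => hy ?_
          have := hτ.2
          simpa [h] using this
        have hc : Tendsto (fun σ : ℝ => g (x + σ • (y - x))) (𝓝[>] τ)
            (𝓝 (g (x + τ • (y - x)))) :=
          ((by fun_prop : Continuous fun σ : ℝ => g (x + σ • (y - x))).tendsto τ).mono_left
            nhdsWithin_le_nhds
        refine tendsto_nhds_unique hc (tendsto_const_nhds.congr' ?_)
        filter_upwards [Ioo_mem_nhdsGT hτ1] with σ hσ
        refine (h0 _ fun hmem => ?_).symm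
        have := hmax (⟨⟨hτ.1.1.trans hσ.1.le, hσ.2.le⟩, hmem⟩ :
          σ ∈ Set.Icc (0 : ℝ) 1 ∩ (fun τ => x + τ • (y - x)) ⁻¹' 𝒳)
        exact absurd hσ.1 (not_lt.2 this)
    have hxz : ‖x - z‖ ≤ ‖x - y‖ := by
      obtain ⟨τ, hτ, rfl⟩ := (segment_eq_image' ℝ x y ▸ hz :
        z ∈ (fun θ : ℝ => x + θ • (y - x)) '' Set.Icc 0 1)
      have : x - (x + τ • (y - x)) = τ • (x - y) := by module
      rw [this, norm_smul, Real.norm_of_nonneg hτ.1]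
      exact mul_le_of_le_one_left (norm_nonneg _) hτ.2
    rw [h0 y hy, ← hz0]
    refine (hL x hx z hzX).trans ?_
    gcongr
    exact le_abs_self L
  by_cases hx : x ∈ 𝒳
  · by_cases hy : y ∈ 𝒳
    · refine (hL x hx y hy).trans ?_
      gcongr
      exact le_abs_self L
    · exact key x hx y hy
  · by_cases hy : y ∈ 𝒳
    · rw [abs_sub_comm, norm_sub_rev]
      exact key y hy x hx
    · rw [h0 x hx, h0 y hy, sub_zero, abs_zero]
      positivity

lemma abs_iteratedFDeriv_sub_le {m : ℕ} {f : EuclideanSpace ℝ (Fin d) → ℝ} {L β : ℝ}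
    (hL : ∀ (i : Fin m → Fin d) (x y : EuclideanSpace ℝ (Fin d)),
      |partialDeriv f i x - partialDeriv f i y| ≤ L * ‖x - y‖ ^ β)
    (x y v : EuclideanSpace ℝ (Fin d)) :
    |iteratedFDeriv ℝ m f x (fun _ => v) - iteratedFDeriv ℝ m f y (fun _ => v)| ≤
      d ^ m * (‖v‖ ^ m * (L * ‖x - y‖ ^ β)) := by
  rw [iteratedFDeriv_apply_const_eq, iteratedFDeriv_apply_const_eq, ← Finset.sum_sub_distrib]
  refine (Finset.abs_sum_le_sum_abs _ _).trans ?_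
  have : ∀ i : Fin m → Fin d,
      |(∏ j, v (i j)) * partialDeriv f i x - (∏ j, v (i j)) * partialDeriv f i y| ≤
      ‖v‖ ^ m * (L * ‖x - y‖ ^ β) := by
    intro i
    rw [← mul_sub, abs_mul, Finset.abs_prod]
    refine mul_le_mul ?_ (hL i x y) (abs_nonneg _) (by positivity)
    refine (Finset.prod_le_prod (fun j _ => abs_nonneg _) (g := fun _ => ‖v‖)
      fun j _ => ?_).trans_eq (by simp)
    exact PiLp.norm_apply_le v (i j)
  refine (Finset.sum_le_sum fun i _ => this i).trans_eq ?_
  simp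

open Nat in
/-- Taylor expansion with a remainder of order `‖y‖ ^ s` for a function whose partial derivatives
of order `m` are Hölder continuous of exponent `s - m`. -/
lemma abs_sub_taylor_le {m : ℕ} {f : EuclideanSpace ℝ (Fin d) → ℝ} (hf : ContDiff ℝ m f)
    {L s : ℝ} (hL0 : 0 ≤ L) (hs : (m : ℝ) ≤ s)
    (hL : ∀ (i : Fin m → Fin d) (x y : EuclideanSpace ℝ (Fin d)),
      |partialDeriv f i x - partialDeriv f i y| ≤ L * ‖x - y‖ ^ (s - m))
    (x y : EuclideanSpace ℝ (Fin d)) :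
    |f (x + y) - ∑ k ∈ Finset.range (m + 1),
      (k ! : ℝ)⁻¹ * iteratedFDeriv ℝ k f x (fun _ => y)| ≤ d ^ m * L * ‖y‖ ^ s := by
  have hpow : ‖y‖ ^ m * ‖y‖ ^ (s - m) = ‖y‖ ^ s := by
    rw [← Real.rpow_natCast, ← Real.rpow_add_of_nonneg (norm_nonneg _) (by positivity)
      (by linarith)]
    ring_nf
  rcases m with _ | n
  · have := abs_iteratedFDeriv_sub_le hL (x + y) x y
    simpa using this
  have hcd : ∀ t ∈ Set.Icc (0 : ℝ) 1, ContDiffAt ℝ (n + 1) f (x + t • y) := fun t _ => by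
    simpa using hf.contDiffAt
  have htaylor := map_add_eq_sum_add_integral_iteratedFDeriv hcd
  rw [htaylor, Finset.sum_range_succ _ (n + 1)]
  simp only [smul_eq_mul]
  rw [add_sub_add_left_eq_sub]
  set D : ℝ → ℝ := fun t => iteratedFDeriv ℝ (n + 1) f (x + t • y) (fun _ => y) with hD
  have hDc : Continuous D := by
    have h1 : Continuous (iteratedFDeriv ℝ (n + 1) f) := hf.continuous_iteratedFDeriv le_rfl
    have h2 : Continuous fun t : ℝ => iteratedFDeriv ℝ (n + 1) f (x + t • y) :=
      h1.comp (by fun_prop)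
    exact (ContinuousMultilinearMap.apply ℝ (fun _ : Fin (n + 1) => EuclideanSpace ℝ (Fin d)) ℝ
      (fun _ => y)).continuous.comp h2
  have hint : ∫ t in (0 : ℝ)..1, (1 - t) ^ n = ((n : ℝ) + 1)⁻¹ := by
    rw [intervalIntegral.integral_comp_sub_left (fun t => t ^ n) 1]
    simp
  have hD0 : iteratedFDeriv ℝ (n + 1) f x (fun _ => y) = D 0 := by simp [hD]
  have hrem : (n ! : ℝ)⁻¹ * (∫ t in (0 : ℝ)..1, (1 - t) ^ n * D t) -
      ((n + 1)! : ℝ)⁻¹ * D 0 =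
      (n ! : ℝ)⁻¹ * ∫ t in (0 : ℝ)..1, (1 - t) ^ n * (D t - D 0) := by
    simp_rw [mul_sub]
    rw [intervalIntegral.integral_sub (by apply Continuous.intervalIntegrable; fun_prop)
      (by apply Continuous.intervalIntegrable; fun_prop), intervalIntegral.integral_mul_const,
      hint, mul_sub, Nat.factorial_succ]
    push_cast
    field_simp
  rw [hD0, hrem, abs_mul, abs_of_nonneg (by positivity), ← Real.norm_eq_abs (∫ t in _.._, _)]
  have hbound : ‖∫ t in (0 : ℝ)..1, (1 - t) ^ n * (D t - D 0)‖ ≤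
      d ^ (n + 1) * L * ‖y‖ ^ s * |1 - 0| := by
    refine intervalIntegral.norm_integral_le_of_norm_le_const fun t ht => ?_
    rw [Set.uIoc_of_le zero_le_one] at ht
    rw [Real.norm_eq_abs, abs_mul]
    have h1 : |(1 - t) ^ n| ≤ 1 := by
      rw [abs_of_nonneg (pow_nonneg (by linarith [ht.2]) n)]
      exact pow_le_one₀ (by linarith [ht.2]) (by linarith [ht.1])
    have h2 : |D t - D 0| ≤ d ^ (n + 1) * L * ‖y‖ ^ s := by
      have := abs_iteratedFDeriv_sub_le hL (x + t • y) x y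
      rw [← hD0]
      refine this.trans ?_
      rw [add_sub_cancel_left, norm_smul, Real.norm_of_nonneg ht.1.le, ← hpow]
      have h3 : (t * ‖y‖) ^ (s - ((n + 1 : ℕ) : ℝ)) ≤ ‖y‖ ^ (s - ((n + 1 : ℕ) : ℝ)) := by
        refine Real.rpow_le_rpow (by have := ht.1; positivity) ?_ (by linarith)
        exact mul_le_of_le_one_left (norm_nonneg _) ht.2
      calc (d : ℝ) ^ (n + 1) * (‖y‖ ^ (n + 1) * (L * (t * ‖y‖) ^ (s - ((n + 1 : ℕ) : ℝ))))
          ≤ (d : ℝ) ^ (n + 1) * (‖y‖ ^ (n + 1) * (L * ‖y‖ ^ (s - ((n + 1 : ℕ) : ℝ)))) := by gcongr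
        _ = _ := by ring
    calc |(1 - t) ^ n| * |D t - D 0| ≤ 1 * (d ^ (n + 1) * L * ‖y‖ ^ s) :=
          mul_le_mul h1 h2 (abs_nonneg _) zero_le_one
      _ = _ := one_mul _
  have hfac : ((n ! : ℝ))⁻¹ ≤ 1 := inv_le_one_of_one_le₀ (by exact_mod_cast Nat.factorial_pos n)
  calc (n ! : ℝ)⁻¹ * ‖∫ t in (0 : ℝ)..1, (1 - t) ^ n * (D t - D 0)‖
      ≤ 1 * (d ^ (n + 1) * L * ‖y‖ ^ s * |1 - 0|) :=
        mul_le_mul hfac hbound (norm_nonneg _) zero_le_one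
    _ = _ := by simp

/-- A kernel of order `m` annihilates the homogeneous Taylor terms of degree `1, …, m`. -/
lemma integral_kernel_mul_iteratedFDeriv {m k : ℕ} {K : EuclideanSpace ℝ (Fin d) → ℝ}
    (hK : IsKernelOfOrder m K) (hk1 : 1 ≤ k) (hkm : k ≤ m) (f : EuclideanSpace ℝ (Fin d) → ℝ)
    (t : EuclideanSpace ℝ (Fin d)) (h : ℝ) :
    Integrable (fun u => K u * iteratedFDeriv ℝ k f t (fun _ => -(h • u))) ∧
      ∫ u, K u * iteratedFDeriv ℝ k f t (fun _ => -(h • u)) = 0 := by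
  classical
  have hmon : ∀ i : Fin k → Fin d, Integrable (fun u : EuclideanSpace ℝ (Fin d) =>
      (∏ j, u (i j)) * K u) ∧ ∫ u : EuclideanSpace ℝ (Fin d), (∏ j, u (i j)) * K u = 0 := by
    intro i
    have hprod : ∀ u : EuclideanSpace ℝ (Fin d), ∏ j, u (i j) =
        ∏ l, u l ^ (Finset.univ.filter fun j => i j = l).card := fun u => by
      rw [← Finset.prod_fiberwise Finset.univ i fun j => u (i j)]
      refine Finset.prod_congr rfl fun l _ => ?_
      rw [Finset.prod_congr rfl fun j hj => by rw [(Finset.mem_filter.1 hj).2]]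
      simp
    have hcard : ∑ l, (Finset.univ.filter fun j => i j = l).card = k := by
      rw [← Finset.card_eq_sum_card_fiberwise fun j _ => Finset.mem_coe.2 (Finset.mem_univ (i j))]
      simp
    simp_rw [hprod]
    exact hK.2 _ (by rw [hcard]; exact hk1) (by rw [hcard]; exact hkm)
  have hexp : ∀ u, K u * iteratedFDeriv ℝ k f t (fun _ => -(h • u)) =
      ∑ i : Fin k → Fin d, ((-h) ^ k * partialDeriv f i t) * ((∏ j, u (i j)) * K u) := by
    intro u
    rw [iteratedFDeriv_apply_const_eq, Finset.mul_sum]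
    refine Finset.sum_congr rfl fun i _ => ?_
    have : ∏ j, (-(h • u)) (i j) = (-h) ^ k * ∏ j, u (i j) := by
      simp only [PiLp.neg_apply, PiLp.smul_apply, smul_eq_mul, ← neg_mul]
      rw [Finset.prod_mul_distrib]
      simp
    rw [this]
    ring
  simp_rw [hexp]
  refine ⟨integrable_finsetSum _ fun i _ => (hmon i).1.const_mul _, ?_⟩
  rw [integral_finsetSum _ fun i _ => (hmon i).1.const_mul _]
  exact Finset.sum_eq_zero fun i _ => by rw [integral_const_mul, (hmon i).2, mul_zero]

/-! ### Bias in a Hölder class -/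

/-- Markov's inequality for the mass of the kernel beyond norm `1 / h`. -/
lemma lintegral_tail_le_moment (K : EuclideanSpace ℝ (Fin d) → ℝ) {s h : ℝ} (hs : 0 < s)
    (hh : 0 < h) :
    ∫⁻ u in {u | 1 / h ≤ ‖u‖}, ‖K u‖ₑ ≤
      ENNReal.ofReal (h ^ s) * ∫⁻ u, ENNReal.ofReal (‖u‖ ^ s * |K u|) := by
  have hS : MeasurableSet {u : EuclideanSpace ℝ (Fin d) | 1 / h ≤ ‖u‖} :=
    measurableSet_le measurable_const measurable_norm
  rw [← lintegral_const_mul' _ _ ENNReal.ofReal_ne_top, ← lintegral_indicator hS]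
  refine lintegral_mono fun u => ?_
  by_cases hu : u ∈ {u : EuclideanSpace ℝ (Fin d) | 1 / h ≤ ‖u‖}
  · rw [Set.indicator_of_mem hu, ← ENNReal.ofReal_mul (by positivity), ← ofReal_norm,
      Real.norm_eq_abs, ← mul_assoc, ← Real.mul_rpow hh.le (norm_nonneg _)]
    refine ENNReal.ofReal_le_ofReal (le_mul_of_one_le_left (abs_nonneg _) ?_)
    refine Real.one_le_rpow ?_ hs.le
    have : 1 / h ≤ ‖u‖ := hu
    rwa [div_le_iff₀' hh] at this
  · rw [Set.indicator_of_notMem hu]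
    exact zero_le

open Nat in
/-- Pointwise bias bound: subtracting the Taylor polynomial of `f` at `t` does not change the
smoothed value minus `f t`, since the kernel annihilates its terms of positive degree. -/
lemma enorm_bias_le_of_holder {m : ℕ} {K f : EuclideanSpace ℝ (Fin d) → ℝ}
    (hK : IsKernelOfOrder m K) (hf : ContDiff ℝ m f) (hfc : HasCompactSupport f) {L s : ℝ}
    (hL0 : 0 ≤ L) (hs : (m : ℝ) ≤ s)
    (hL : ∀ (i : Fin m → Fin d) (x y : EuclideanSpace ℝ (Fin d)),
      |partialDeriv f i x - partialDeriv f i y| ≤ L * ‖x - y‖ ^ (s - m))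
    {h : ℝ} (hh : 0 < h) (t : EuclideanSpace ℝ (Fin d)) :
    ‖(h ^ d)⁻¹ * smooth K f h t - f t‖ₑ ≤
      ENNReal.ofReal (d ^ m * L * h ^ s) * ∫⁻ u, ENNReal.ofReal (‖u‖ ^ s * |K u|) := by
  have hb : (h ^ d) ≠ 0 := (pow_pos hh d).ne'
  have hi : Integrable fun u => K u * f (t - h • u) := by
    obtain ⟨C, hC⟩ := hf.continuous.bounded_above_of_compact_support hfc
    have hc : Continuous fun u : EuclideanSpace ℝ (Fin d) => f (t - h • u) :=
      hf.continuous.comp (by fun_prop)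
    exact hK.1.1.mul_bdd hc.aestronglyMeasurable (ae_of_all _ fun u => hC _)
  have hterm : ∀ k ∈ Finset.range m, Integrable (fun u => K u * ((k + 1)! : ℝ)⁻¹ *
      iteratedFDeriv ℝ (k + 1) f t (fun _ => -(h • u))) ∧ ∫ u, K u * ((k + 1)! : ℝ)⁻¹ *
      iteratedFDeriv ℝ (k + 1) f t (fun _ => -(h • u)) = 0 := by
    intro k hk
    obtain ⟨h1, h2⟩ := integral_kernel_mul_iteratedFDeriv hK (Nat.le_add_left 1 k)
      (Finset.mem_range.1 hk) f t h
    have : ∀ u, K u * ((k + 1)! : ℝ)⁻¹ * iteratedFDeriv ℝ (k + 1) f t (fun _ => -(h • u)) =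
        ((k + 1)! : ℝ)⁻¹ * (K u * iteratedFDeriv ℝ (k + 1) f t (fun _ => -(h • u))) :=
      fun u => by ring
    simp_rw [this]
    exact ⟨h1.const_mul _, by rw [integral_const_mul, h2, mul_zero]⟩
  have htaylor : ∀ u, K u * ∑ k ∈ Finset.range (m + 1),
      (k ! : ℝ)⁻¹ * iteratedFDeriv ℝ k f t (fun _ => -(h • u)) =
      (∑ k ∈ Finset.range m, K u * ((k + 1)! : ℝ)⁻¹ *
        iteratedFDeriv ℝ (k + 1) f t (fun _ => -(h • u))) + K u * f t := by
    intro u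
    rw [Finset.sum_range_succ', mul_add, Finset.mul_sum]
    simp [mul_assoc]
  have hTi : Integrable fun u => K u * ∑ k ∈ Finset.range (m + 1),
      (k ! : ℝ)⁻¹ * iteratedFDeriv ℝ k f t (fun _ => -(h • u)) := by
    simp_rw [htaylor]
    exact (integrable_finsetSum _ fun k hk => (hterm k hk).1).add (hK.1.1.mul_const _)
  have hT : ∫ u, K u * ∑ k ∈ Finset.range (m + 1),
      (k ! : ℝ)⁻¹ * iteratedFDeriv ℝ k f t (fun _ => -(h • u)) = f t := by
    simp_rw [htaylor]
    rw [integral_add (integrable_finsetSum _ fun k hk => (hterm k hk).1) (hK.1.1.mul_const _),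
      integral_finsetSum _ fun k hk => (hterm k hk).1,
      Finset.sum_eq_zero fun k hk => (hterm k hk).2, integral_mul_const, hK.1.2]
    ring
  rw [smooth_eq K f hh, inv_mul_cancel_left₀ hb]
  nth_rw 1 [← hT]
  rw [← integral_sub hi hTi]
  refine (enorm_integral_le_lintegral_enorm _).trans ?_
  rw [← lintegral_const_mul' _ _ ENNReal.ofReal_ne_top]
  refine lintegral_mono fun u => ?_
  rw [← mul_sub, enorm_mul, ← ENNReal.ofReal_mul (by positivity), ← ofReal_norm, ← ofReal_norm,
    ← ENNReal.ofReal_mul (norm_nonneg _)]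
  refine ENNReal.ofReal_le_ofReal ?_
  have h1 := abs_sub_taylor_le hf hL0 hs hL t (-(h • u))
  rw [← sub_eq_add_neg, norm_neg, norm_smul, Real.norm_of_nonneg hh.le,
    Real.mul_rpow hh.le (norm_nonneg _)] at h1
  rw [Real.norm_eq_abs, Real.norm_eq_abs]
  refine (mul_le_mul_of_nonneg_left h1 (abs_nonneg (K u))).trans_eq ?_
  ring

/-- The integrated bias is of order `h ^ s` over a Hölder class of smoothness `s`. -/
lemma exists_lintegral_bias_le {K f : EuclideanSpace ℝ (Fin d) → ℝ} {s L : ℝ} (hs : 0 < s)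
    (hKm : Measurable K) (hK : IsKernelOfOrder ⌊s⌋₊ K)
    (hKs : Integrable fun u => ‖u‖ ^ s * |K u|) (hfm : Measurable f)
    (hf1 : ∫⁻ x, ‖f x‖ₑ = 1) {𝒳 : Set (EuclideanSpace ℝ (Fin d))} (h𝒳 : IsCompact 𝒳)
    (hf : f ∈ HolderClass 𝒳 s L) :
    ∃ C : ℝ≥0∞, C ≠ ∞ ∧ ∀ h : ℝ, 0 < h →
      ∫⁻ t, ‖(h ^ d)⁻¹ * smooth K f h t - f t‖ₑ ≤ C * ENNReal.ofReal (h ^ s) := by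
  obtain ⟨hsupp, -, hcd, hhol⟩ := hf
  obtain ⟨R, hR⟩ := h𝒳.isBounded.subset_closedBall 0
  have hms : ((⌊s⌋₊ : ℕ) : ℝ) ≤ s := Nat.floor_le hs.le
  have hfc : HasCompactSupport f := HasCompactSupport.intro h𝒳 fun x hx => by
    by_contra hne
    exact hx (hsupp hne)
  have hL : ∀ (i : Fin ⌊s⌋₊ → Fin d) (x y : EuclideanSpace ℝ (Fin d)),
      |partialDeriv f i x - partialDeriv f i y| ≤ |L| * ‖x - y‖ ^ (s - (⌊s⌋₊ : ℝ)) := fun i =>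
    abs_sub_le_of_holderOn (continuous_partialDeriv hcd i) h𝒳.isClosed
      (fun x hx => partialDeriv_eq_zero h𝒳.isClosed hsupp i hx) (by linarith) (hhol i)
  set M := ∫⁻ u, ENNReal.ofReal (‖u‖ ^ s * |K u|) with hM
  have hMt : M ≠ ∞ := by
    have := hKs.hasFiniteIntegral
    rw [hasFiniteIntegral_iff_ofReal (ae_of_all _ fun u => by positivity)] at this
    exact this.ne
  set B := Metric.closedBall (0 : EuclideanSpace ℝ (Fin d)) (R + 1) with hB
  have mB : MeasurableSet B := Metric.isClosed_closedBall.measurableSet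
  have hf0 : ∀ x, R < ‖x‖ → f x = 0 := fun x hx => by
    by_contra hne
    have := hR (hsupp hne)
    rw [mem_closedBall_zero_iff] at this
    linarith
  refine ⟨ENNReal.ofReal (d ^ ⌊s⌋₊ * |L|) * M * volume B + M, ?_, fun h hh => ?_⟩
  · exact ENNReal.add_ne_top.2 ⟨ENNReal.mul_ne_top (ENNReal.mul_ne_top ENNReal.ofReal_ne_top hMt)
      measure_closedBall_lt_top.ne, hMt⟩
  have hb : 0 < h ^ d := pow_pos hh d
  have hin : ∫⁻ t in B, ‖(h ^ d)⁻¹ * smooth K f h t - f t‖ₑ ≤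
      ENNReal.ofReal (d ^ ⌊s⌋₊ * |L|) * M * volume B * ENNReal.ofReal (h ^ s) := by
    refine (lintegral_mono fun t =>
      enorm_bias_le_of_holder hK hcd hfc (abs_nonneg L) hms hL hh t).trans_eq ?_
    rw [setLIntegral_const, ENNReal.ofReal_mul (by positivity)]
    ring
  have hout : ∫⁻ t in Bᶜ, ‖(h ^ d)⁻¹ * smooth K f h t - f t‖ₑ ≤ M * ENNReal.ofReal (h ^ s) := by
    calc ∫⁻ t in Bᶜ, ‖(h ^ d)⁻¹ * smooth K f h t - f t‖ₑ
        ≤ ∫⁻ t in Bᶜ, ENNReal.ofReal (h ^ d)⁻¹ *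
            ∫⁻ x, ‖K (h⁻¹ • (t - x))‖ₑ * ‖f x‖ₑ := by
          refine setLIntegral_mono' mB.compl fun t ht => ?_
          have ht' : R < ‖t‖ := by
            simp only [hB, Set.mem_compl_iff, mem_closedBall_zero_iff, not_le] at ht
            linarith
          rw [hf0 t ht', sub_zero, enorm_mul, Real.enorm_of_nonneg (inv_nonneg.2 hb.le)]
          gcongr
          refine (enorm_integral_le_lintegral_enorm _).trans_eq ?_
          simp [enorm_mul]
      _ ≤ ENNReal.ofReal (h ^ d)⁻¹ * (ENNReal.ofReal (h ^ d) *
            (ENNReal.ofReal (h ^ s) * M)) := by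
          rw [lintegral_const_mul' _ _ ENNReal.ofReal_ne_top]
          gcongr
          refine (lintegral_tail_le hKm hfm hh R 1).trans ?_
          gcongr
          have hz : ∫⁻ x in {x | R < ‖x‖}, ‖f x‖ₑ = 0 := by
            rw [setLIntegral_congr_fun (g := fun _ => 0)
              (measurableSet_lt measurable_const measurable_norm) fun x hx => by
                simp [hf0 x hx]]
            simp
          rw [hz, mul_zero, add_zero, hf1, mul_one]
          exact lintegral_tail_le_moment K hs hh
      _ = M * ENNReal.ofReal (h ^ s) := by
          rw [← mul_assoc, ← ENNReal.ofReal_mul (by positivity), inv_mul_cancel₀ hb.ne']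
          simp [mul_comm]
  rw [← lintegral_add_compl _ mB, add_mul]
  exact add_le_add hin hout

/-! ### Discrete components, null sets and measurable versions -/

lemma tsum_measure_singleton_le {S : Type*} [MeasurableSpace S] [MeasurableSingletonClass S]
    {μ : Measure S} [IsProbabilityMeasure μ] {A : Set S} (hA : A.Countable) :
    ∑' a : A, μ {(a : S)} ≤ 1 := by
  have : Countable A := hA
  rw [← measure_iUnion (fun a b hab => by simpa [Subtype.ext_iff, eq_comm] using hab)
    fun a => measurableSet_singleton _]
  exact prob_le_one

/-- For a fixed law, the expected proportion of strays tends to `0`, by dominated convergence. -/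
lemma tendsto_tsum_measure_singleton {S : Type*} [MeasurableSpace S]
    [MeasurableSingletonClass S] {μ : Measure S} [IsProbabilityMeasure μ] {A : Set S}
    (hA : A.Countable) :
    Tendsto (fun n : ℕ => ∑' a : A, μ {(a : S)} * (1 - μ {(a : S)}) ^ (n - 1)) atTop (𝓝 0) := by
  have : Countable A := hA
  simp_rw [← lintegral_count]
  have h0 : (0 : ℝ≥0∞) = ∫⁻ _ : A, 0 ∂Measure.count := by simp
  rw [h0]
  refine tendsto_lintegral_filter_of_dominated_convergence (fun a => μ {(a : S)})
    (Eventually.of_forall fun n => Measurable.of_discrete)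
    (Eventually.of_forall fun n => ae_of_all _ fun a => ?_) ?_ (ae_of_all _ fun a => ?_)
  · exact mul_le_of_le_one_right' (pow_le_one' tsub_le_self _)
  · rw [lintegral_count]
    exact ((tsum_measure_singleton_le hA).trans_lt ENNReal.one_lt_top).ne
  · by_cases ha : μ {(a : S)} = 0
    · simp [ha]
    · have h1 : (1 : ℝ≥0∞) - μ {(a : S)} < 1 :=
        ENNReal.sub_lt_self ENNReal.one_ne_top one_ne_zero ha
      have h2 := (ENNReal.tendsto_pow_atTop_nhds_zero_of_lt_one h1).comp (tendsto_sub_atTop_nat 1)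
      have h3 := ENNReal.Tendsto.const_mul (a := μ {(a : S)}) h2 (Or.inr (measure_ne_top _ _))
      simpa using h3

section Mixture

variable {π₁ : ℝ} {f : EuclideanSpace ℝ (Fin d) → ℝ} {H : PMF (EuclideanSpace ℝ (Fin d))}

lemma hasContinuousPart_mixture (hd : 0 < d) (hπ₀ : 0 < π₁) (hπ₁ : π₁ < 1) (hfm : Measurable f)
    (hf : IsDensity f) :
    HasContinuousPart (mixture π₁ f H) H.support (1 - π₁) f := by
  have : Nonempty (Fin d) := ⟨⟨0, hd⟩⟩
  have hf1 : ∫⁻ x, ENNReal.ofReal (f x) = 1 := by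
    rw [← ofReal_integral_eq_lintegral_ofReal hf.2.1 (ae_of_all _ hf.1), hf.2.2,
      ENNReal.ofReal_one]
  have hc : H.support.Countable := H.support_countable
  refine ⟨⟨?_⟩, hc, by linarith, by linarith, hfm, hf.1, ?_, ?_⟩
  · simp only [mixture, Measure.add_apply, Measure.smul_apply, smul_eq_mul,
      withDensity_apply _ MeasurableSet.univ, Measure.restrict_univ, hf1, mul_one, measure_univ]
    rw [← ENNReal.ofReal_add (by linarith) hπ₀.le]
    simp
  · simp_rw [fun x => Real.enorm_of_nonneg (hf.1 x)]
    exact hf1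
  · rw [mixture, Measure.restrict_add, Measure.restrict_smul, Measure.restrict_smul]
    have h1 : (H.toMeasure).restrict H.supportᶜ = 0 := by
      rw [Measure.restrict_eq_zero, PMF.toMeasure_apply_eq_zero_iff _ hc.measurableSet.compl]
      exact disjoint_compl_right
    have h2 : (volume.withDensity fun x => ENNReal.ofReal (f x)).restrict H.supportᶜ =
        volume.withDensity fun x => ENNReal.ofReal (f x) := by
      rw [restrict_withDensity hc.measurableSet.compl,
        Measure.restrict_eq_self_of_ae_mem (s := H.supportᶜ)
          (compl_mem_ae_iff.2 (hc.measure_zero volume))]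
    rw [h1, h2, smul_zero, add_zero]

lemma mixture_singleton (hd : 0 < d) (a : EuclideanSpace ℝ (Fin d)) :
    mixture π₁ f H {a} = ENNReal.ofReal π₁ * H a := by
  have : Nonempty (Fin d) := ⟨⟨0, hd⟩⟩
  rw [mixture, Measure.add_apply, Measure.smul_apply, Measure.smul_apply,
    withDensity_apply _ (measurableSet_singleton a),
    PMF.toMeasure_apply_singleton _ _ (measurableSet_singleton a)]
  simp

end Mixture

section Congr

lemma ae_comp_inv_smul_sub {p : EuclideanSpace ℝ (Fin d) → Prop} (hp : ∀ᵐ u, p u) {h : ℝ}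
    (hh : 0 < h) (x : EuclideanSpace ℝ (Fin d)) : ∀ᵐ t, p (h⁻¹ • (t - x)) := by
  classical
  set N := toMeasurable volume {u | ¬ p u} with hN
  have hN0 : volume N = 0 := by rw [hN, measure_toMeasurable]; exact hp
  have mN : MeasurableSet N := measurableSet_toMeasurable _ _
  have h1 := lintegral_comp_inv_smul_sub (N.indicator 1) hh x
  rw [lintegral_indicator_one mN, hN0, mul_zero, lintegral_eq_zero_iff (by
    exact (measurable_one.indicator mN).comp (by fun_prop))] at h1
  filter_upwards [h1] with t ht
  by_contra hne
  have : h⁻¹ • (t - x) ∈ N := subset_toMeasurable _ _ hne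
  simp [Set.indicator_of_mem this] at ht

/-- The risk depends on the kernel, the density and the sample only up to null sets. -/
lemma MIAE_congr {Ω : Type*} [MeasurableSpace Ω] {P : Measure Ω} {n : ℕ}
    {X Y : Fin n → Ω → EuclideanSpace ℝ (Fin d)} (hXY : ∀ i, X i =ᵐ[P] Y i)
    {K K' f f' : EuclideanSpace ℝ (Fin d) → ℝ} (hK : K =ᵐ[volume] K') (hf : f =ᵐ[volume] f')
    {h : ℝ} (hh : 0 < h) : MIAE P X K h f = MIAE P Y K' h f' := by
  refine lintegral_congr_ae ?_
  filter_upwards [ae_all_iff.2 hXY] with ω hω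
  simp_rw [hω]
  refine lintegral_congr_ae ?_
  have hKae : ∀ i, ∀ᵐ t, K (h⁻¹ • (t - Y i ω)) = K' (h⁻¹ • (t - Y i ω)) := fun i =>
    ae_comp_inv_smul_sub hK hh (Y i ω)
  filter_upwards [hf, ae_all_iff.2 hKae] with t ht hKt
  simp only [uniqueKDE, hKt, ht]

lemma IsIIDSample.congr {Ω : Type*} [MeasurableSpace Ω] {P : Measure Ω} {n : ℕ}
    {X Y : Fin n → Ω → EuclideanSpace ℝ (Fin d)} {μ : Measure (EuclideanSpace ℝ (Fin d))}
    (hX : IsIIDSample X μ P) (hXY : ∀ i, X i =ᵐ[P] Y i) : IsIIDSample Y μ P :=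
  ⟨fun i => (hX.1 i).congr (hXY i).symm, (iIndepFun_congr hXY).1 hX.2⟩

lemma mixture_congr {π₁ : ℝ} {f f' : EuclideanSpace ℝ (Fin d) → ℝ} (hf : f =ᵐ[volume] f')
    (H : PMF (EuclideanSpace ℝ (Fin d))) : mixture π₁ f H = mixture π₁ f' H := by
  rw [mixture, mixture, withDensity_congr_ae (g := fun x => ENNReal.ofReal (f' x))]
  filter_upwards [hf] with x hx
  rw [hx]

lemma IsKernel.congr {K K' : EuclideanSpace ℝ (Fin d) → ℝ} (hK : IsKernel K)
    (h : K =ᵐ[volume] K') : IsKernel K' :=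
  ⟨hK.1.congr h, by rw [← integral_congr_ae h, hK.2]⟩

lemma IsKernelOfOrder.congr {m : ℕ} {K K' : EuclideanSpace ℝ (Fin d) → ℝ}
    (hK : IsKernelOfOrder m K) (h : K =ᵐ[volume] K') : IsKernelOfOrder m K' := by
  refine ⟨hK.1.congr h, fun r h1 h2 => ?_⟩
  have : (fun u : EuclideanSpace ℝ (Fin d) => (∏ i, u i ^ r i) * K u) =ᵐ[volume]
      fun u => (∏ i, u i ^ r i) * K' u := by
    filter_upwards [h] with u hu
    rw [hu]
  exact ⟨(hK.2 r h1 h2).1.congr this, by rw [← integral_congr_ae this, (hK.2 r h1 h2).2]⟩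

lemma IsDensity.exists_measurable {f : EuclideanSpace ℝ (Fin d) → ℝ} (hf : IsDensity f) :
    ∃ g, Measurable g ∧ IsDensity g ∧ f =ᵐ[volume] g := by
  have hae : f =ᵐ[volume] fun x => max (hf.2.1.aestronglyMeasurable.mk f x) 0 := by
    filter_upwards [hf.2.1.aestronglyMeasurable.ae_eq_mk] with x hx
    rw [← hx, max_eq_left (hf.1 x)]
  refine ⟨_, hf.2.1.aestronglyMeasurable.stronglyMeasurable_mk.measurable.max measurable_const,
    ⟨fun x => le_max_right _ _, hf.2.1.congr hae, ?_⟩, hae⟩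
  rw [← integral_congr_ae hae, hf.2.2]

end Congr

/-! ### Consistency and rate -/

lemma tendsto_const_mul_zero {ι : Type*} {l : Filter ι} {a : ι → ℝ≥0∞} {c : ℝ≥0∞} (hc : c ≠ ∞)
    (ha : Tendsto a l (𝓝 0)) : Tendsto (fun i => c * a i) l (𝓝 0) := by
  simpa using ENNReal.Tendsto.const_mul ha (Or.inr hc)

lemma tendsto_ofReal_zero {ι : Type*} {l : Filter ι} {a : ι → ℝ} (ha : Tendsto a l (𝓝 0)) :
    Tendsto (fun i => ENNReal.ofReal (a i)) l (𝓝 0) := by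
  simpa using ENNReal.tendsto_ofReal ha

/-- Consistency in mean `L¹` for a fixed law. The kernel is approximated in `L¹` by a continuous
compactly supported one, whose fluctuation on a large ball is of order `(n * h ^ d) ^ (-1 / 2)`. -/
theorem tendsto_MIAE {Ω : Type*} [MeasurableSpace Ω] {P : Measure Ω}
    {μ : Measure (EuclideanSpace ℝ (Fin d))} {A : Set (EuclideanSpace ℝ (Fin d))} {p : ℝ}
    {K f : EuclideanSpace ℝ (Fin d) → ℝ} (hd : 0 < d) (hμ : HasContinuousPart μ A p f)
    {X : (n : ℕ) → Fin n → Ω → EuclideanSpace ℝ (Fin d)} (hX : ∀ n i, Measurable (X n i))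
    (hs : ∀ n, IsIIDSample (X n) μ P) (hKm : Measurable K) (hK : IsKernel K)
    {h : ℕ → ℝ} (hh : Tendsto h atTop (𝓝[>] 0))
    (hnh : Tendsto (fun n : ℕ => (n : ℝ) * h n ^ d) atTop atTop) :
    Tendsto (fun n => MIAE P (X n) K (h n) f) atTop (𝓝 0) := by
  have := hμ.prob
  rw [ENNReal.tendsto_nhds_zero]
  intro ε hε
  -- The kernel approximation and the tail of `f` cost `4 * (δ + δ)`, all other terms tend to `0`.
  set δ := ε / 16 with hδ
  have hεδ : ε = 16 * δ := (ENNReal.mul_div_cancel (by norm_num) (by norm_num)).symm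
  have hδ0 : δ ≠ 0 := by simp [hδ, hε.ne']
  set k := ∫⁻ u, ‖K u‖ₑ with hk
  have hkt : k ≠ ∞ := hK.1.hasFiniteIntegral.ne
  have hkt' : k + 1 ≠ ∞ := by simpa using hkt
  obtain ⟨K₁, hK₁c, hKK₁, hK₁, hK₁i⟩ := hK.1.exists_hasCompactSupport_lintegral_sub_le hδ0
  have hκ : ∫⁻ u, ‖K₁ u‖ₑ ^ 2 ≠ ∞ := by
    have h1 := (hK₁.memLp_of_hasCompactSupport (p := 2) (μ := volume) hK₁c).2
    rw [eLpNorm_lt_top_iff_lintegral_rpow_enorm_lt_top (by norm_num) (by norm_num)] at h1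
    simpa using h1.ne
  obtain ⟨R, hR⟩ : ∃ R : ℝ, k * ∫⁻ x in {x | R < ‖x‖}, ‖f x‖ₑ ≤ δ := by
    have h1 := tendsto_const_mul_zero hkt (tendsto_lintegral_tail hμ.integrable)
    obtain ⟨R, hR⟩ := ((ENNReal.tendsto_nhds_zero.1 h1) δ (pos_iff_ne_zero.2 hδ0)).exists
    refine ⟨R, le_trans (mul_le_mul_right (lintegral_mono_set ?_) k) hR⟩
    exact fun x (hx : R < ‖x‖) => hx.le
  set V := (volume (Metric.closedBall (0 : EuclideanSpace ℝ (Fin d)) (R + 1)) *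
        ∫⁻ u, ‖K₁ u‖ₑ ^ 2) ^ (1 / 2 : ℝ) with hV
  have hVt : V ≠ ∞ := ENNReal.rpow_ne_top_of_nonneg (by norm_num)
    (ENNReal.mul_ne_top measure_closedBall_lt_top.ne hκ)
  have ninv : Tendsto (fun n : ℕ => ((n : ℝ))⁻¹) atTop (𝓝 0) := tendsto_inv_atTop_nhds_zero_nat
  have nsqrt : Tendsto (fun n : ℕ => (√(n : ℝ))⁻¹) atTop (𝓝 0) :=
    (Real.tendsto_sqrt_atTop.comp tendsto_natCast_atTop_atTop).inv_tendsto_atTop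
  have t1 : Tendsto (fun n => 2 * ∫⁻ t, ‖(h n ^ d)⁻¹ * smooth K f (h n) t - f t‖ₑ) atTop (𝓝 0) :=
    tendsto_const_mul_zero (by norm_num)
      ((tendsto_lintegral_bias hKm hμ.measurable hK hμ.integrable).comp hh)
  have t2 : Tendsto (fun n : ℕ => V * ENNReal.ofReal (2 / p * (√(n * h n ^ d))⁻¹)) atTop
      (𝓝 0) := by
    refine tendsto_const_mul_zero hVt (tendsto_ofReal_zero ?_)
    simpa using ((Real.tendsto_sqrt_atTop.comp hnh).inv_tendsto_atTop).const_mul (2 / p)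
  have t3 : Tendsto (fun n => 4 * ∫⁻ u in {u | 1 / h n ≤ ‖u‖}, ‖K u‖ₑ) atTop (𝓝 0) := by
    refine tendsto_const_mul_zero (by norm_num) ((tendsto_lintegral_tail hK.1).comp ?_)
    simpa [Function.comp_def] using tendsto_inv_nhdsGT_zero.comp hh
  have t4 : Tendsto (fun n => (k + 1) * ENNReal.ofReal (2 / p) *
      (∑' a : A, μ {(a : EuclideanSpace ℝ (Fin d))} *
        (1 - μ {(a : EuclideanSpace ℝ (Fin d))}) ^ (n - 1))) atTop (𝓝 0) :=
    tendsto_const_mul_zero (ENNReal.mul_ne_top hkt' ENNReal.ofReal_ne_top)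
      (tendsto_tsum_measure_singleton hμ.countable)
  have t5 : Tendsto (fun n : ℕ => ENNReal.ofReal (2 / p * ((√n)⁻¹ + (n : ℝ)⁻¹))) atTop (𝓝 0) := by
    refine tendsto_ofReal_zero ?_
    simpa using (nsqrt.add ninv).const_mul (2 / p)
  have t6 : Tendsto (fun n : ℕ => (k + 1) * ENNReal.ofReal (4 / p ^ 2 * (n : ℝ)⁻¹)) atTop
      (𝓝 0) := by
    refine tendsto_const_mul_zero hkt' (tendsto_ofReal_zero ?_)
    simpa using ninv.const_mul (4 / p ^ 2)
  have tsum := ((((t1.add t2).add t3).add t4).add t5).add t6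
  simp only [add_zero] at tsum
  have h8 : (0 : ℝ≥0∞) < 8 * δ := by positivity
  filter_upwards [ENNReal.tendsto_nhds_zero.1 tsum (8 * δ) h8, eventually_gt_atTop 0,
    hh.eventually self_mem_nhdsWithin] with n hn hn0 hhn
  refine (hμ.MIAE_le hd hn0 (hX n) (hs n) hKm hK.1 hK₁.measurable hK₁i hhn R 1).trans ?_
  rw [← hk, ← hV]
  calc _ ≤ (2 * (∫⁻ t, ‖(h n ^ d)⁻¹ * smooth K f (h n) t - f t‖ₑ) +
        V * ENNReal.ofReal (2 / p * (√(n * h n ^ d))⁻¹) +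
        4 * (δ + ((∫⁻ u in {u | 1 / h n ≤ ‖u‖}, ‖K u‖ₑ) + δ)) +
        (k + 1) * ENNReal.ofReal (2 / p) * (∑' a : A, μ {(a : EuclideanSpace ℝ (Fin d))} *
          (1 - μ {(a : EuclideanSpace ℝ (Fin d))}) ^ (n - 1)) +
        ENNReal.ofReal (2 / p * ((√n)⁻¹ + (n : ℝ)⁻¹)) +
        (k + 1) * ENNReal.ofReal (4 / p ^ 2 * (n : ℝ)⁻¹)) := by gcongr
    _ = (2 * (∫⁻ t, ‖(h n ^ d)⁻¹ * smooth K f (h n) t - f t‖ₑ) +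
        V * ENNReal.ofReal (2 / p * (√(n * h n ^ d))⁻¹) +
        4 * (∫⁻ u in {u | 1 / h n ≤ ‖u‖}, ‖K u‖ₑ) +
        (k + 1) * ENNReal.ofReal (2 / p) * (∑' a : A, μ {(a : EuclideanSpace ℝ (Fin d))} *
          (1 - μ {(a : EuclideanSpace ℝ (Fin d))}) ^ (n - 1)) +
        ENNReal.ofReal (2 / p * ((√n)⁻¹ + (n : ℝ)⁻¹)) +
        (k + 1) * ENNReal.ofReal (4 / p ^ 2 * (n : ℝ)⁻¹)) + 8 * δ := by ring
    _ ≤ 8 * δ + 8 * δ := by gcongr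
    _ = ε := by rw [hεδ]; ring

/-- The lower bound on the atom masses says that each atom is missed by `n - 1` observations with
probability at most `c * n ^ e`. -/
lemma tsum_mixture_singleton_le {π₁ c e : ℝ} (hd : 0 < d) (hπ₀ : 0 < π₁)
    {f : EuclideanSpace ℝ (Fin d) → ℝ} {H : PMF (EuclideanSpace ℝ (Fin d))}
    (hprob : IsProbabilityMeasure (mixture π₁ f H)) (hc : 0 < c) {n : ℕ} (hn : 2 ≤ n)
    (hmin : ∀ a ∈ H.support, 1 / π₁ * (1 - (c * (n : ℝ) ^ e) ^ (1 / ((n : ℝ) - 1))) ≤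
      (H a).toReal) :
    ∑' a : H.support, mixture π₁ f H {(a : EuclideanSpace ℝ (Fin d))} *
      (1 - mixture π₁ f H {(a : EuclideanSpace ℝ (Fin d))}) ^ (n - 1) ≤
      ENNReal.ofReal (c * (n : ℝ) ^ e) := by
  have hy : 0 ≤ c * (n : ℝ) ^ e := by positivity
  have hpow : ∀ a : H.support, (1 - mixture π₁ f H {(a : EuclideanSpace ℝ (Fin d))}) ^ (n - 1) ≤
      ENNReal.ofReal (c * (n : ℝ) ^ e) := by
    intro a
    have h1 := hmin a a.2
    rw [one_div_mul_eq_div, div_le_iff₀ hπ₀] at h1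
    have h2 : 1 - mixture π₁ f H {(a : EuclideanSpace ℝ (Fin d))} ≤
        ENNReal.ofReal ((c * (n : ℝ) ^ e) ^ (1 / ((n : ℝ) - 1))) := by
      rw [mixture_singleton hd, ← ENNReal.ofReal_toReal (H.apply_ne_top a), ← ENNReal.ofReal_one,
        ← ENNReal.ofReal_mul hπ₀.le, ← ENNReal.ofReal_sub _ (by positivity)]
      exact ENNReal.ofReal_le_ofReal (by linarith)
    refine (pow_le_pow_left' h2 (n - 1)).trans_eq ?_
    rw [← ENNReal.ofReal_pow (by positivity), ← Real.rpow_natCast, ← Real.rpow_mul hy]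
    have h3 : (0 : ℝ) < (n : ℝ) - 1 := by
      have : (2 : ℝ) ≤ n := by exact_mod_cast hn
      linarith
    rw [Nat.cast_sub (by omega), Nat.cast_one, one_div_mul_cancel h3.ne', Real.rpow_one]
  calc _ ≤ ∑' a : H.support, mixture π₁ f H {(a : EuclideanSpace ℝ (Fin d))} *
        ENNReal.ofReal (c * (n : ℝ) ^ e) := by
        gcongr with a
        exact hpow a
    _ ≤ 1 * ENNReal.ofReal (c * (n : ℝ) ^ e) := by
        rw [ENNReal.tsum_mul_right]
        gcongr
        exact tsum_measure_singleton_le H.support_countable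
    _ = _ := one_mul _

/-- The rate `n ^ (-s / (2 * s + d))` for a triangular array whose atoms are all heavy enough to be
repeated with high probability. Every term of `HasContinuousPart.MIAE_le` is at most a constant
multiple of it; the kernel need not be split, since it is square integrable. -/
theorem exists_MIAE_le_rate {Ω : Type*} [MeasurableSpace Ω] {P : Measure Ω} (hd : 0 < d)
    {π₁ : ℝ} (hπ₀ : 0 < π₁) (hπ₁ : π₁ < 1) {K f : EuclideanSpace ℝ (Fin d) → ℝ}
    (hf : IsDensity f)
    {X : (n : ℕ) → Fin n → Ω → EuclideanSpace ℝ (Fin d)} (hX : ∀ n i, Measurable (X n i))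
    {H : ℕ → PMF (EuclideanSpace ℝ (Fin d))}
    (hiid : ∀ n, IsIIDSample (X n) (mixture π₁ f (H n)) P) (hKm : Measurable K)
    {s c : ℝ} (hs : 0 < s) (hc : 0 < c)
    (hmin : ∀ᶠ n : ℕ in atTop, ∀ a ∈ (H n).support,
      1 / π₁ * (1 - (c * (n : ℝ) ^ (-(2 * s) / (2 * s + d))) ^ (1 / ((n : ℝ) - 1))) ≤
        ((H n) a).toReal)
    (hK : IsKernelOfOrder ⌊s⌋₊ K) (hK2 : Integrable fun u => K u ^ 2)
    (hKs : Integrable fun u => ‖u‖ ^ s * |K u|)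
    {𝒳 : Set (EuclideanSpace ℝ (Fin d))} (h𝒳 : IsCompact 𝒳) {L : ℝ}
    (hfL : f ∈ HolderClass 𝒳 s L) {α : ℝ} (hα : 0 < α) :
    ∃ C : ℝ, ∀ᶠ n : ℕ in atTop,
      MIAE P (X n) K (α * (n : ℝ) ^ (-1 / (2 * s + d))) f ≤
        ENNReal.ofReal (C * (n : ℝ) ^ (-s / (2 * s + d))) := by
  have hfm : Measurable f := hfL.2.2.1.continuous.measurable
  have hμ := fun n => hasContinuousPart_mixture (H := H n) hd hπ₀ hπ₁ hfm hf
  have hf1 := (hμ 0).lintegral_eq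
  obtain ⟨C₁, hC₁, hbias⟩ := exists_lintegral_bias_le hs hKm hK hKs hfm hf1 h𝒳 hfL
  obtain ⟨R, hR⟩ := h𝒳.isBounded.subset_closedBall 0
  set p := 1 - π₁ with hp
  have hp0 : 0 < p := by linarith
  set k := ∫⁻ u, ‖K u‖ₑ with hk
  have hkt : k + 1 ≠ ∞ := by simpa using hK.1.1.hasFiniteIntegral.ne
  have hκ : ∫⁻ u, ‖K u‖ₑ ^ 2 ≠ ∞ := by
    have := hK2.hasFiniteIntegral
    simp only [HasFiniteIntegral, enorm_pow] at this
    exact this.ne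
  set M := ∫⁻ u, ENNReal.ofReal (‖u‖ ^ s * |K u|) with hM
  have hMt : M ≠ ∞ := by
    have := hKs.hasFiniteIntegral
    rw [hasFiniteIntegral_iff_ofReal (ae_of_all _ fun u => by positivity)] at this
    exact this.ne
  set V := (volume (Metric.closedBall (0 : EuclideanSpace ℝ (Fin d)) (R + 1)) *
        ∫⁻ u, ‖K u‖ₑ ^ 2) ^ (1 / 2 : ℝ) with hV
  have hVt : V ≠ ∞ := ENNReal.rpow_ne_top_of_nonneg (by norm_num)
    (ENNReal.mul_ne_top measure_closedBall_lt_top.ne hκ)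
  have hz : ∫⁻ x in {x | R < ‖x‖}, ‖f x‖ₑ = 0 := by
    rw [setLIntegral_congr_fun (g := fun _ => 0)
      (measurableSet_lt measurable_const measurable_norm) fun x hx => by
        have : f x = 0 := by
          by_contra hne
          have h1 := hR (hfL.1 hne)
          rw [mem_closedBall_zero_iff] at h1
          exact absurd hx (not_lt.2 h1)
        simp [this]]
    simp
  set C : ℝ≥0∞ := 2 * (C₁ * ENNReal.ofReal (α ^ s)) +
    V * ENNReal.ofReal (2 / p * (√(α ^ d))⁻¹) + 4 * (ENNReal.ofReal (α ^ s) * M) +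
    (k + 1) * ENNReal.ofReal (2 / p) * ENNReal.ofReal c + ENNReal.ofReal (4 / p) +
    (k + 1) * ENNReal.ofReal (4 / p ^ 2) with hC
  have hCt : C ≠ ∞ := by
    simp only [hC, ne_eq, ENNReal.add_eq_top, not_or]
    have hk4 : (4 : ℝ≥0∞) ≠ ∞ := by norm_num
    have hk2 : (2 : ℝ≥0∞) ≠ ∞ := by norm_num
    refine ⟨⟨⟨⟨⟨?_, ?_⟩, ?_⟩, ?_⟩, ?_⟩, ?_⟩ <;>
      simp only [← ne_eq] <;> (repeat' apply ENNReal.mul_ne_top) <;>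
      first | assumption | exact ENNReal.ofReal_ne_top
  refine ⟨C.toReal, ?_⟩
  filter_upwards [hmin, eventually_ge_atTop 2] with n hn hn2
  have hn1 : (1 : ℝ) ≤ n := by exact_mod_cast (by omega : 1 ≤ n)
  have hn0 : (0 : ℝ) < n := by linarith
  have hq : 0 < 2 * s + d := by positivity
  set r := (n : ℝ) ^ (-s / (2 * s + d)) with hr
  have hr0 : 0 < r := by positivity
  set h := α * (n : ℝ) ^ (-1 / (2 * s + d)) with hh
  have hh0 : 0 < h := by positivity
  have hhs : h ^ s = α ^ s * r := by
    rw [hh, Real.mul_rpow hα.le (by positivity), ← Real.rpow_mul hn0.le]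
    congr 2
    ring
  -- The bandwidth balances bias and fluctuation: `n * h ^ d` is proportional to `r ^ (-2)`.
  have hnh : (√(n * h ^ d))⁻¹ = (√(α ^ d))⁻¹ * r := by
    have : (n : ℝ) * h ^ d = α ^ d * (r⁻¹) ^ 2 := by
      rw [hh, mul_pow, hr, ← Real.rpow_neg hn0.le, ← Real.rpow_natCast (_ ^ _) d,
        ← Real.rpow_natCast (_ ^ _) 2, ← Real.rpow_mul hn0.le, ← Real.rpow_mul hn0.le,
        mul_left_comm]
      congr 1
      nth_rw 1 [← Real.rpow_one (n : ℝ)]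
      rw [← Real.rpow_add hn0]
      congr 1
      push_cast
      field_simp
      ring
    rw [this, Real.sqrt_mul (by positivity), Real.sqrt_sq (by positivity), mul_inv, inv_inv]
  have hrate : ∀ e : ℝ, e ≤ -s / (2 * s + d) → (n : ℝ) ^ e ≤ r := fun e he =>
    Real.rpow_le_rpow_of_exponent_le hn1 he
  have hr2 : (n : ℝ) ^ (-(2 * s) / (2 * s + d)) ≤ r :=
    hrate _ (div_le_div_of_nonneg_right (by linarith) hq.le)
  have hrinv : ((n : ℝ))⁻¹ ≤ r := by
    rw [← Real.rpow_neg_one]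
    refine hrate _ ?_
    rw [le_div_iff₀ hq]
    have : (0 : ℝ) ≤ d := Nat.cast_nonneg d
    linarith
  have hrsqrt : (√(n : ℝ))⁻¹ ≤ r := by
    rw [Real.sqrt_eq_rpow, ← Real.rpow_neg hn0.le]
    refine hrate _ ?_
    rw [le_div_iff₀ hq]
    have : (0 : ℝ) ≤ d := Nat.cast_nonneg d
    linarith
  have hmaster := (hμ n).MIAE_le hd (by omega) (hX n) (hiid n) hKm hK.1.1 hKm hK.1.1 hh0 R 1
  refine hmaster.trans ?_
  rw [← hk, ← hV, hz, ENNReal.ofReal_mul ENNReal.toReal_nonneg, ENNReal.ofReal_toReal hCt, hnh]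
  simp only [sub_self, enorm_zero, lintegral_zero, mul_zero, add_zero, zero_add]
  calc _ ≤ 2 * (C₁ * ENNReal.ofReal (h ^ s)) +
        V * ENNReal.ofReal (2 / p * ((√(α ^ d))⁻¹ * r)) +
        4 * (ENNReal.ofReal (h ^ s) * M) +
        (k + 1) * ENNReal.ofReal (2 / p) * ENNReal.ofReal (c * r) +
        ENNReal.ofReal (2 / p * (r + r)) +
        (k + 1) * ENNReal.ofReal (4 / p ^ 2 * r) := by
        gcongr
        · exact hbias h hh0
        · exact lintegral_tail_le_moment K hs hh0
        · refine (tsum_mixture_singleton_le hd hπ₀ (hμ n).prob hc hn2 hn).trans ?_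
          gcongr
    _ = C * ENNReal.ofReal r := by
        have e1 : 2 / p * (r + r) = 4 / p * r := by ring
        have e2 : 2 / p * ((√(α ^ d))⁻¹ * r) = 2 / p * (√(α ^ d))⁻¹ * r := by ring
        rw [e1, e2, hhs, ENNReal.ofReal_mul (q := r) (by positivity),
          ENNReal.ofReal_mul (q := r) (by positivity), ENNReal.ofReal_mul (q := r) (by positivity),
          ENNReal.ofReal_mul (q := r) (by positivity), ENNReal.ofReal_mul (q := r) (by positivity)]
        ring

end AtomKDE

theorem theorem2p2 {d : ℕ} (hd : 0 < d) {Ω : Type*} [MeasurableSpace Ω] (P : Measure Ω)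
    [IsProbabilityMeasure P] (π₁ : ℝ) (hπ₀ : 0 < π₁) (hπ₁ : π₁ < 1)
    (f : EuclideanSpace ℝ (Fin d) → ℝ) (hf : AtomKDE.IsDensity f)
    (K : EuclideanSpace ℝ (Fin d) → ℝ) (hK : AtomKDE.IsKernel K)
    (X : (n : ℕ) → Fin n → Ω → EuclideanSpace ℝ (Fin d)) :
    -- consistency, for a fixed discrete component
    (∀ H : PMF (EuclideanSpace ℝ (Fin d)),
      (∀ n, AtomKDE.IsIIDSample (X n) (AtomKDE.mixture π₁ f H) P) →
      ∀ h : ℕ → ℝ, Tendsto h atTop (𝓝[>] 0) →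
        Tendsto (fun n : ℕ => (n : ℝ) * h n ^ d) atTop atTop →
        Tendsto (fun n => AtomKDE.MIAE P (X n) K (h n) f) atTop (𝓝 0)) ∧
    -- rate, for a triangular array of finitely supported discrete components
    (∀ H : ℕ → PMF (EuclideanSpace ℝ (Fin d)),
      (∀ n, AtomKDE.IsIIDSample (X n) (AtomKDE.mixture π₁ f (H n)) P) →
      (∀ n, (H n).support.Finite) →
      ∀ s : ℝ, 0 < s → ∀ c : ℝ, 0 < c →
      (∀ᶠ n : ℕ in atTop, ∀ a ∈ (H n).support,
        1 / π₁ * (1 - (c * (n : ℝ) ^ (-(2 * s) / (2 * s + d))) ^ (1 / ((n : ℝ) - 1))) ≤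
          ((H n) a).toReal) →
      AtomKDE.IsKernelOfOrder ⌊s⌋₊ K →
      Integrable (fun u => K u ^ 2) →
      Integrable (fun u => ‖u‖ ^ s * |K u|) →
      ∀ 𝒳 : Set (EuclideanSpace ℝ (Fin d)), IsCompact 𝒳 →
      ∀ L : ℝ, f ∈ AtomKDE.HolderClass 𝒳 s L →
      ∀ α : ℝ, 0 < α →
      ∃ C : ℝ, ∀ᶠ n : ℕ in atTop,
        AtomKDE.MIAE P (X n) K (α * (n : ℝ) ^ (-1 / (2 * s + d))) f ≤
          ENNReal.ofReal (C * (n : ℝ) ^ (-s / (2 * s + d)))) := by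
  -- `K`, `f` and the observations are replaced by measurable versions; in the second part `f` is
  -- continuous and is kept.
  obtain ⟨g, hgm, hg, hfg⟩ := hf.exists_measurable
  have hKm := hK.1.aestronglyMeasurable.stronglyMeasurable_mk.measurable
  have hKK := hK.1.aestronglyMeasurable.ae_eq_mk
  set K' := hK.1.aestronglyMeasurable.mk K with hK'
  refine ⟨fun H hiid h hh hnh => ?_, fun H hiid _ s hs c hc hmin hKo hK2 hKs 𝒳 h𝒳 L hfL α hα => ?_⟩
  · have hXX := fun n i => ((hiid n).1 i).aemeasurable.ae_eq_mk
    have hmain := AtomKDE.tendsto_MIAE hd (AtomKDE.hasContinuousPart_mixture hd hπ₀ hπ₁ hgm hg)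
      (fun n i => ((hiid n).1 i).aemeasurable.measurable_mk)
      (fun n => by
        rw [← AtomKDE.mixture_congr hfg H]
        exact (hiid n).congr (hXX n)) hKm (hK.congr hKK) hh hnh
    refine hmain.congr' ?_
    filter_upwards [hh.eventually self_mem_nhdsWithin] with n hn
    exact (AtomKDE.MIAE_congr (hXX n) hKK hfg hn).symm
  · have hXX := fun n i => ((hiid n).1 i).aemeasurable.ae_eq_mk
    obtain ⟨C, hC⟩ := AtomKDE.exists_MIAE_le_rate hd hπ₀ hπ₁ hf
      (fun n i => ((hiid n).1 i).aemeasurable.measurable_mk)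
      (fun n => (hiid n).congr (hXX n)) hKm hs hc hmin (hKo.congr hKK)
      (hK2.congr (by filter_upwards [hKK] with u hu; rw [hu]))
      (hKs.congr (by filter_upwards [hKK] with u hu; rw [hu])) h𝒳 hfL hα
    refine ⟨C, ?_⟩
    filter_upwards [hC, eventually_gt_atTop 0] with n hn hn0
    have hn0' : (0 : ℝ) < n := by exact_mod_cast hn0
    rwa [AtomKDE.MIAE_congr (hXX n) hKK (ae_eq_refl f) (by positivity)]
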